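/- Let $Z$ be a complete separable metric space, let $X\subseteq Z$ be an analytic subset (with the induced metric), let $Y$ be a separable metric space and $(\Lambda,\mathcal P)$ a probability space. Let $\pi:\Lambda\times X\to Y$ be measurable (for the product of the $\sigma$-algebra of $\Lambda$ with the Borel $\sigma$-algebra of $X$, and the Borel $\sigma$-algebra of $Y$), and write $\pi_\lambda=\pi(\lambda,\cdot)$. Suppose that there are real numbers $\alpha,\kappa,C>0$ such that $$\mathcal P\big[\lambda\in\Lambda:\ d(\pi_\lambda(x_1),\pi_\lambda(x_2))\le\delta\, d(x_1,x_2)^\alpha\big]\le C\delta^\kappa$$ for all $\delta>0$ and all distinct $x_1,x_2\in X$. Let $\dim$ denote Hausdorff dimension. Then $$\dim\pi_\lambda(X)\ \ge\ \min\!\left(\kappa,\frac{\dim X}{\alpha}\right)\qquad\text{for }\mathcal P\text{-a.e. }\lambda\in\Lambda.$$ If moreover $\kappa=\dim Y$ and, in the case $\dim X<\alpha\kappa$, every map $\pi_\lambda$ is $\alpha$-Hölder (that is, there is a constant $K_\lambda$ with $d(\pi_\lambda(x_1),\pi_\lambda(x_2))\le K_\lambda\, d(x_1,x_2)^\alpha$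 for all $x_1,x_2\in X$), then $$\dim\pi_\lambda(X)=\min\!\left(\kappa,\frac{\dim X}{\alpha}\right)\qquad\text{for }\mathcal P\text{-a.e. }\lambda\in\Lambda.$$ -/

import Mathlib

open MeasureTheory Set
open scoped NNReal ENNReal

/-- The family of maps `π l : X → Y`, `l ∈ Λ`, is transversal with respect to `P`, with exponents
`α`, `κ` and constant `C`. The points are distinct: for `x₁ = x₂` the event on the left
is the whole parameter space, for every `δ`. -/
def IsTransversal {Λ X Y : Type*} [MeasurableSpace Λ] [MetricSpace X] [MetricSpace Y]
    (P : Measure Λ) (π : Λ → X → Y) (α κ C : ℝ≥0) : Prop :=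
  ∀ δ : ℝ, 0 < δ → ∀ x₁ x₂ : X, x₁ ≠ x₂ →
    P {l | dist (π l x₁) (π l x₂) ≤ δ * dist x₁ x₂ ^ (α : ℝ)} ≤ ENNReal.ofReal (C * δ ^ (κ : ℝ))

/-!
Frostman's lemma: if `s < dimH X` and `X` is analytic, then `X` carries a probability measure `μ`
that gives every ball of dyadic radius `r` mass `O(r ^ s)`. If `α * s < dimH X` and `s < κ`, such a
measure for an exponent above `α * s` has finite `α * s`-energy. By transversality
`∫⁻ l, edist (π l x₁) (π l x₂) ^ (-s) ∂P` is at most a constant multiple of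
`edist x₁ x₂ ^ (-(α * s))`, so by Tonelli the image of `μ` under almost every `π l` has finite
`s`-energy, which forces `s ≤ dimH (range (π l))`.

Frostman's lemma itself comes from the dyadic content. The content is not continuous along
increasing sequences of sets, but it becomes so modulo sets of dimension at most `t`: where the
covers of the members have no limit their pieces wander off, and averaging over many covers discards
the wandering pieces. Choquet capacitability gives a compact set all of whose open neighbourhoods
have large content. As a fractional cover can be made honest at the price of a slightly larger
exponent, linear programming duality on this compact set and the Riesz representation theorem
produce `μ`.
-/

open Filter Topology Metric

/-- A countable family of sets sorted by dyadic scales: finitely many sets of diameter at most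
`2⁻ᵏ` are listed at scale `k`. The same set may be listed at several scales. -/
structure DyadicFamily (Z : Type*) [PseudoEMetricSpace Z] where
  pieces : ℕ → Finset (Set Z)
  ediam_le : ∀ k, ∀ E ∈ pieces k, ediam E ≤ 2⁻¹ ^ k

namespace DyadicFamily

variable {Z : Type*} [PseudoEMetricSpace Z]

/-- The set covered by a dyadic family. -/
def carrier (F : DyadicFamily Z) : Set Z := ⋃ k, ⋃ E ∈ F.pieces k, E

/-- The cost of a dyadic family when a set listed at scale `k` is charged `x ^ k`; for
`x = 2⁻ᵗ` this is its `t`-dimensional Hausdorff sum. -/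
noncomputable def cost (F : DyadicFamily Z) (x : ℝ≥0∞) : ℝ≥0∞ :=
  ∑' k, ((F.pieces k).card : ℝ≥0∞) * x ^ k

theorem mem_carrier {F : DyadicFamily Z} {z : Z} :
    z ∈ F.carrier ↔ ∃ k, ∃ E ∈ F.pieces k, z ∈ E := by
  simp [carrier]

theorem pow_le_cost {F : DyadicFamily Z} {k : ℕ} (hk : (F.pieces k).Nonempty) (x : ℝ≥0∞) :
    x ^ k ≤ F.cost x :=
  (le_mul_of_one_le_left zero_le (by exact_mod_cast hk.card_pos)).trans (ENNReal.le_tsum k)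

open Classical in
/-- The family listing the members of both families. -/
noncomputable def union (F G : DyadicFamily Z) : DyadicFamily Z where
  pieces k := F.pieces k ∪ G.pieces k
  ediam_le k E hE := (Finset.mem_union.1 hE).elim (F.ediam_le k E) (G.ediam_le k E)

theorem carrier_union (F G : DyadicFamily Z) : (F.union G).carrier = F.carrier ∪ G.carrier := by
  ext z
  simp only [mem_carrier, union, Finset.mem_union, mem_union]
  grind

theorem cost_union_le (F G : DyadicFamily Z) (x : ℝ≥0∞) :
    (F.union G).cost x ≤ F.cost x + G.cost x := by
  rw [cost, cost, cost, ← ENNReal.tsum_add]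
  gcongr with k
  rw [← add_mul]
  gcongr
  exact_mod_cast Finset.card_union_le _ _

end DyadicFamily

section Content

variable {Z : Type*} [PseudoEMetricSpace Z]

/-- The infimal cost of covering `A` by a dyadic family with scale weights `x ^ k`. For `x = 2⁻ᵗ` it
is a dyadic variant of the `t`-dimensional Hausdorff content. -/
noncomputable def dyadicContent (x : ℝ≥0∞) (A : Set Z) : ℝ≥0∞ :=
  ⨅ (F : DyadicFamily Z) (_ : A ⊆ F.carrier), F.cost x

theorem dyadicContent_le_cost {x : ℝ≥0∞} {A : Set Z} {F : DyadicFamily Z} (hA : A ⊆ F.carrier) :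
    dyadicContent x A ≤ F.cost x :=
  iInf₂_le F hA

theorem exists_cost_lt_of_dyadicContent_lt {x : ℝ≥0∞} {A : Set Z} {a : ℝ≥0∞}
    (h : dyadicContent x A < a) : ∃ F : DyadicFamily Z, A ⊆ F.carrier ∧ F.cost x < a := by
  simpa only [dyadicContent, iInf_lt_iff, exists_prop] using h

theorem dyadicContent_mono (x : ℝ≥0∞) {A B : Set Z} (h : A ⊆ B) :
    dyadicContent x A ≤ dyadicContent x B :=
  le_iInf₂ fun _ hB => dyadicContent_le_cost (h.trans hB)

theorem dyadicContent_union_le (x : ℝ≥0∞) (A B : Set Z) :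
    dyadicContent x (A ∪ B) ≤ dyadicContent x A + dyadicContent x B := by
  simp_rw [dyadicContent, ENNReal.iInf_add, ENNReal.add_iInf]
  refine le_iInf₂ fun F hF => le_iInf₂ fun G hG => ?_
  refine (dyadicContent_le_cost ?_).trans (F.cost_union_le G x)
  rw [F.carrier_union G]
  exact union_subset_union hF hG

theorem inv_two_pow_rpow (t : ℝ) (k : ℕ) : ((2 : ℝ≥0∞)⁻¹ ^ k) ^ t = ((2 : ℝ≥0∞) ^ (-t)) ^ k := by
  rw [← ENNReal.rpow_natCast, ← ENNReal.rpow_natCast, ← ENNReal.rpow_mul,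
    ENNReal.inv_rpow, ← ENNReal.rpow_neg, ← ENNReal.rpow_mul]
  congr 1
  ring

theorem two_rpow_ne_zero (t : ℝ) : (2 : ℝ≥0∞) ^ t ≠ 0 := by
  simp [ENNReal.rpow_eq_zero_iff]

theorem two_rpow_ne_top (t : ℝ) : (2 : ℝ≥0∞) ^ t ≠ ⊤ := by
  simp [ENNReal.rpow_eq_top_iff]

theorem two_rpow_neg_lt_one {t : ℝ} (ht : 0 < t) : (2 : ℝ≥0∞) ^ (-t) < 1 := by
  rw [ENNReal.rpow_neg, ENNReal.inv_lt_one]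
  exact ENNReal.one_lt_rpow (by norm_num) ht

theorem DyadicFamily.tsum_ediam_rpow_le (F : DyadicFamily Z) {t : ℝ} (ht : 0 ≤ t) :
    ∑' p : Σ k, F.pieces k, ediam (p.2 : Set Z) ^ t ≤ F.cost (2 ^ (-t)) := by
  rw [ENNReal.tsum_sigma', cost]
  refine ENNReal.tsum_le_tsum fun k => ?_
  calc ∑' E : F.pieces k, ediam (E : Set Z) ^ t
      ≤ ∑' _ : F.pieces k, ((2 : ℝ≥0∞) ^ (-t)) ^ k := by
        refine ENNReal.tsum_le_tsum fun E => ?_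
        rw [← inv_two_pow_rpow]
        exact ENNReal.rpow_le_rpow (F.ediam_le k E E.2) ht
    _ = _ := by simp

end Content

theorem dimH_le_of_dyadicContent_eq_zero {Z : Type*} [EMetricSpace Z] {t : ℝ≥0} (ht : 0 < t)
    {A : Set Z} (h : dyadicContent ((2 : ℝ≥0∞) ^ (-(t : ℝ))) A = 0) : dimH A ≤ t := by
  borelize Z
  set x : ℝ≥0∞ := (2 : ℝ≥0∞) ^ (-(t : ℝ))
  have hx1 : x < 1 := two_rpow_neg_lt_one (by exact_mod_cast ht)
  have hcov (m : ℕ) : ∃ F : DyadicFamily Z, A ⊆ F.carrier ∧ F.cost x < x ^ m :=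
    exists_cost_lt_of_dyadicContent_lt (h ▸ pos_iff_ne_zero.2 (pow_ne_zero m (two_rpow_ne_zero _)))
  choose F hA hcost using hcov
  -- A family of cost less than `x ^ m` lists nothing at the scales below `m`.
  have hscale (m k : ℕ) (hk : ((F m).pieces k).Nonempty) : m ≤ k := by
    by_contra! hlt
    exact ((pow_le_pow_right_of_le_one' hx1.le hlt.le).trans
      (DyadicFamily.pow_le_cost hk x)).not_gt (hcost m)
  have hzero : μH[(t : ℝ)] A ≤ liminf (fun m => x ^ m) atTop := by
    refine (Measure.hausdorffMeasure_le_liminf_tsum (t : ℝ) A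
      (fun m : ℕ => (2 : ℝ≥0∞)⁻¹ ^ m)
      (ENNReal.tendsto_pow_atTop_nhds_zero_of_lt_one (by simp))
      (fun m (p : Σ k, (F m).pieces k) => (p.2 : Set Z))
      (Eventually.of_forall fun m p => ?_) (Eventually.of_forall fun m z hz => ?_)).trans
      (liminf_le_liminf (Eventually.of_forall fun m =>
        ((F m).tsum_ediam_rpow_le t.2).trans (hcost m).le))
    · exact ((F m).ediam_le p.1 p.2 p.2.2).trans
        (pow_le_pow_right_of_le_one' (by simp) (hscale m p.1 ⟨p.2, p.2.2⟩))
    · obtain ⟨k, E, hE, hzE⟩ := DyadicFamily.mem_carrier.1 (hA m hz)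
      exact mem_iUnion.2 ⟨⟨k, E, hE⟩, hzE⟩
  rw [(ENNReal.tendsto_pow_atTop_nhds_zero_of_lt_one hx1).liminf_eq] at hzero
  exact dimH_le_of_hausdorffMeasure_ne_top (hzero.trans_lt ENNReal.zero_lt_top).ne

section Fractional

variable {Z : Type*} [PseudoEMetricSpace Z]

theorem tsum_indicator_le_of_isSeparated {C E : Set Z} {r : ℝ≥0∞} (hC : IsSeparated r C)
    (hE : ediam E ≤ r) (a : ℝ≥0∞) : ∑' z : C, E.indicator (fun _ => a) (z : Z) ≤ a := by
  by_cases hex : ∃ y : C, (y : Z) ∈ E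
  · obtain ⟨y, hy⟩ := hex
    rw [tsum_eq_single y fun z hzy => indicator_of_notMem (fun hz => ?_) _]
    · exact indicator_le_self _ _ _
    · exact (hC z.2 y.2 (Subtype.coe_ne_coe.2 hzy)).not_ge (edist_le_of_ediam_le hz hy hE)
  · push Not at hex
    simp [hex]

theorem coveringNumber_mul_le_tsum {ι : Type*} {S : Set Z} (w : ι → ℝ≥0∞) (E : ι → Set Z)
    {r : ℝ≥0} {θ : ℝ≥0∞} (hE : ∀ i, ediam (E i) ≤ r)
    (hS : ∀ z ∈ S, θ ≤ ∑' i, (E i).indicator (fun _ => w i) z) :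
    (coveringNumber r S : ℝ≥0∞) * θ ≤ ∑' i, w i := by
  have hpack (C : Set Z) (hCS : C ⊆ S) (hC : IsSeparated r C) : C.encard * θ ≤ ∑' i, w i :=
    calc (C.encard : ℝ≥0∞) * θ = ∑' _ : C, θ := (ENNReal.tsum_set_const C θ).symm
      _ ≤ ∑' z : C, ∑' i, (E i).indicator (fun _ => w i) (z : Z) :=
        ENNReal.tsum_le_tsum fun z => hS z (hCS z.2)
      _ = ∑' i, ∑' z : C, (E i).indicator (fun _ => w i) (z : Z) := ENNReal.tsum_comm
      _ ≤ ∑' i, w i := ENNReal.tsum_le_tsum fun i => tsum_indicator_le_of_isSeparated hC (hE i) _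
  refine le_trans (mul_le_mul_left (ENat.toENNReal_le.2 (coveringNumber_le_packingNumber r S)) θ) ?_
  simp_rw [packingNumber, ENat.toENNReal_iSup, ENNReal.iSup_mul]
  exact iSup_le fun C => iSup₂_le (hpack C)

theorem ediam_closedEBall_inv_two_pow_le (z : Z) (k : ℕ) :
    ediam (closedEBall z (2⁻¹ ^ (k + 1))) ≤ 2⁻¹ ^ k := by
  refine ediam_closedEBall_le.trans_eq ?_
  rw [pow_succ', ← mul_assoc, ENNReal.mul_inv_cancel (by simp) (by simp), one_mul]

theorem coe_inv_two_pow (k : ℕ) : ((2⁻¹ ^ k : ℝ≥0) : ℝ≥0∞) = 2⁻¹ ^ k := by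
  rw [ENNReal.coe_pow, ENNReal.coe_inv_two]

theorem dyadicContent_le_tsum_coveringNumber {x : ℝ≥0∞} (hx : x ≠ 0) {A : Set Z}
    (S : ℕ → Set Z) (hA : A ⊆ ⋃ k, S k) :
    dyadicContent x A ≤ ∑' k, (coveringNumber (2⁻¹ ^ (k + 1)) (S k) : ℝ≥0∞) * x ^ k := by
  classical
  by_cases hfin : ∀ k, coveringNumber (2⁻¹ ^ (k + 1)) (S k) ≠ ⊤
  swap
  · push Not at hfin
    obtain ⟨k, hk⟩ := hfin
    refine le_top.trans (le_trans (top_le_iff.2 ?_) (ENNReal.le_tsum k))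
    rw [hk, ENat.toENNReal_top, ENNReal.top_mul (pow_ne_zero k hx)]
  let C (k : ℕ) : Finset Z := (finite_minimalCover (ε := 2⁻¹ ^ (k + 1)) (A := S k)).toFinset
  let F : DyadicFamily Z :=
    { pieces := fun k => (C k).image fun z => closedEBall z (2⁻¹ ^ (k + 1))
      ediam_le := fun k => Finset.forall_mem_image.2 fun z _ =>
        ediam_closedEBall_inv_two_pow_le z k }
  have hAF : A ⊆ F.carrier := fun z hz => by
    obtain ⟨k, hzk⟩ := mem_iUnion.1 (hA hz)
    obtain ⟨c, hc, hzc⟩ := isCover_minimalCover (hfin k) hzk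
    refine DyadicFamily.mem_carrier.2 ⟨k, _, Finset.mem_image_of_mem _
      ((finite_minimalCover).mem_toFinset.2 hc), ?_⟩
    exact hzc.trans_eq (coe_inv_two_pow _)
  refine (dyadicContent_le_cost hAF).trans (ENNReal.tsum_le_tsum fun k => ?_)
  gcongr
  calc ((F.pieces k).card : ℝ≥0∞) ≤ (C k).card := by exact_mod_cast Finset.card_image_le
    _ = _ := by
      rw [← encard_minimalCover (hfin k), ← ENat.toENNReal_coe, ← encard_coe_eq_coe_finsetCard]
      simp [C]

namespace DyadicFamily

variable {ι : Type*} (c : ι → ℝ≥0∞) (F : ι → DyadicFamily Z)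

/-- The multiplicity with which the weighted families cover a point at scale `k`. -/
noncomputable def weightAt (k : ℕ) (z : Z) : ℝ≥0∞ :=
  ∑' p : Σ i, (F i).pieces k, (p.2 : Set Z).indicator (fun _ => c p.1) z

theorem tsum_indicator_carrier_le (z : Z) :
    ∑' i, (F i).carrier.indicator (fun _ => c i) z ≤ ∑' k, weightAt c F k z := by
  simp_rw [weightAt, ENNReal.tsum_sigma']
  rw [ENNReal.tsum_comm]
  refine ENNReal.tsum_le_tsum fun i => indicator_apply_le' (fun hz => ?_) fun _ => zero_le
  obtain ⟨k, E, hE, hzE⟩ := mem_carrier.1 hz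
  refine le_trans ?_ ((ENNReal.le_tsum ⟨E, hE⟩).trans (ENNReal.le_tsum k))
  simp [hzE]

theorem tsum_mul_cost (x : ℝ≥0∞) :
    ∑' i, c i * (F i).cost x =
      ∑' k, (∑' p : Σ i, (F i).pieces k, c p.1) * x ^ k := by
  simp_rw [cost, ← ENNReal.tsum_mul_left]
  rw [ENNReal.tsum_comm]
  refine tsum_congr fun k => ?_
  rw [← ENNReal.tsum_mul_right, ENNReal.tsum_sigma']
  refine tsum_congr fun i => ?_
  rw [ENNReal.tsum_mul_right, tsum_fintype]
  simp only [Finset.sum_const, Finset.card_univ, Fintype.card_coe, nsmul_eq_mul]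
  ring

end DyadicFamily

theorem div_lt_one_of_lt_of_ne_top {x y : ℝ≥0∞} (hyx : y < x) (hx : x ≠ ⊤) : y / x < 1 := by
  rwa [ENNReal.div_lt_iff (.inl (pos_of_gt hyx).ne') (.inl hx), one_mul]

theorem half_one_sub_div_ne_zero {x y : ℝ≥0∞} (hyx : y < x) (hx : x ≠ ⊤) :
    (1 - y / x) / 2 ≠ 0 :=
  ENNReal.div_ne_zero.2
    ⟨(tsub_pos_of_lt (div_lt_one_of_lt_of_ne_top hyx hx)).ne', ENNReal.ofNat_ne_top⟩

/-- A geometric pigeonhole: the thresholds `(1 - q) / 2 * q ^ k` sum to `1 / 2`. -/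
theorem exists_le_of_one_le_tsum {q : ℝ≥0∞} (hq : q < 1) {f : ℕ → ℝ≥0∞} (hf : 1 ≤ ∑' k, f k) :
    ∃ k, (1 - q) / 2 * q ^ k ≤ f k := by
  by_contra! hcon
  have hsum : ∑' k, f k ≤ 2⁻¹ :=
    calc ∑' k, f k ≤ ∑' k, (1 - q) / 2 * q ^ k := ENNReal.tsum_le_tsum fun k => (hcon k).le
      _ = 2⁻¹ := by
        rw [ENNReal.tsum_mul_left, ENNReal.tsum_geometric, ENNReal.div_eq_inv_mul, mul_assoc,
          ENNReal.mul_inv_cancel (tsub_pos_of_lt hq).ne' (ENNReal.sub_ne_top ENNReal.one_ne_top),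
          mul_one]
  exact absurd (hf.trans hsum) (by simp)

/-- A fractional cover by dyadic families yields an honest cover, at the price of a slightly larger
exponent. The balls replacing the pieces are twice as large, hence the shift by one scale, the
factor `y` and the condition that scale `0` is empty. -/
theorem mul_dyadicContent_le_tsum_cost {ι : Type*} {x y : ℝ≥0∞} (hy : y ≠ 0) (hyx : y < x)
    (hx : x ≠ ⊤) {S : Set Z} (c : ι → ℝ≥0∞) (F : ι → DyadicFamily Z)
    (hF : ∀ i, (F i).pieces 0 = ∅)
    (hS : ∀ z ∈ S, 1 ≤ ∑' i, (F i).carrier.indicator (fun _ => c i) z) :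
    (1 - y / x) / 2 * (y * dyadicContent y S) ≤ ∑' i, c i * (F i).cost x := by
  have hx0 : x ≠ 0 := (pos_of_gt hyx).ne'
  have hq : y / x < 1 := div_lt_one_of_lt_of_ne_top hyx hx
  set q := y / x
  have hqx : q * x = y := ENNReal.div_mul_cancel hx0 hx
  let T (k : ℕ) : Set Z := {z | (1 - q) / 2 * q ^ k ≤ DyadicFamily.weightAt c F k z}
  have hS_cover : S ⊆ ⋃ k, T (k + 1) := fun z hz => by
    obtain ⟨k, hk⟩ := exists_le_of_one_le_tsum hq
      ((hS z hz).trans (DyadicFamily.tsum_indicator_carrier_le c F z))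
    cases k with
    | zero =>
      have : IsEmpty (Σ i, (F i).pieces 0) := ⟨fun p => by simpa [hF] using p.2.2⟩
      rw [DyadicFamily.weightAt, tsum_empty, pow_zero, mul_one, nonpos_iff_eq_zero,
        ENNReal.div_eq_zero_iff, tsub_eq_zero_iff_le] at hk
      exact absurd hk (by simp [hq])
    | succ k => exact mem_iUnion.2 ⟨k, hk⟩
  have hT (k : ℕ) : (coveringNumber (2⁻¹ ^ k) (T k) : ℝ≥0∞) * ((1 - q) / 2 * q ^ k) ≤
      ∑' p : Σ i, (F i).pieces k, c p.1 :=
    coveringNumber_mul_le_tsum _ (fun p : Σ i, (F i).pieces k => (p.2 : Set Z))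
      (fun p => ((F p.1).ediam_le k p.2 p.2.2).trans_eq (coe_inv_two_pow k).symm) fun z hz => hz
  calc (1 - q) / 2 * (y * dyadicContent y S)
      ≤ (1 - q) / 2 * (y * ∑' k, (coveringNumber (2⁻¹ ^ (k + 1)) (T (k + 1)) : ℝ≥0∞) * y ^ k) := by
        gcongr
        exact dyadicContent_le_tsum_coveringNumber hy _ hS_cover
    _ = ∑' k, (coveringNumber (2⁻¹ ^ (k + 1)) (T (k + 1)) : ℝ≥0∞) *
          ((1 - q) / 2 * q ^ (k + 1)) * x ^ (k + 1) := by
        rw [← ENNReal.tsum_mul_left, ← ENNReal.tsum_mul_left]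
        refine tsum_congr fun k => ?_
        rw [← hqx]
        ring
    _ ≤ ∑' k, (∑' p : Σ i, (F i).pieces (k + 1), c p.1) * x ^ (k + 1) := by
        gcongr with k
        exact hT (k + 1)
    _ ≤ ∑' k, (∑' p : Σ i, (F i).pieces k, c p.1) * x ^ k :=
        ENNReal.tsum_comp_le_tsum_of_injective (Nat.succ_injective)
          fun k => (∑' p : Σ i, (F i).pieces k, c p.1) * x ^ k
    _ = _ := (DyadicFamily.tsum_mul_cost c F x).symm

end Fractional

section Wandering

variable {Z ι : Type*}

/-- A sequence of sets wanders along an ultrafilter if each of its members is disjoint from almost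
all of them. -/
def IsWandering (𝒰 : Ultrafilter ι) (E : ι → Set Z) : Prop :=
  ∀ m, ∀ᶠ n in 𝒰, Disjoint (E m) (E n)

/-- The limit of a sequence of sets along an ultrafilter, in the sense of Kuratowski: the points
all of whose neighbourhoods meet almost all of the sets. -/
def ultraLimit [TopologicalSpace Z] (𝒰 : Ultrafilter ι) (E : ι → Set Z) : Set Z :=
  {z | ∀ V ∈ 𝓝 z, ∀ᶠ n in 𝒰, (V ∩ E n).Nonempty}

theorem ediam_ultraLimit_le [PseudoEMetricSpace Z] {𝒰 : Ultrafilter ι} {E : ι → Set Z} {r : ℝ≥0∞}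
    (hE : ∀ n, ediam (E n) ≤ r) : ediam (ultraLimit 𝒰 E) ≤ r := by
  refine ediam_le fun z hz y hy => ENNReal.le_of_forall_pos_le_add fun ε hε _ => ?_
  have hε2 : (0 : ℝ≥0∞) < ε / 2 := by simpa using hε.ne'
  obtain ⟨n, ⟨z', hz', hz'E⟩, y', hy', hy'E⟩ :=
    ((hz _ (eball_mem_nhds z hε2)).and (hy _ (eball_mem_nhds y hε2))).exists
  calc edist z y ≤ edist z z' + edist z' y' + edist y' y := edist_triangle4 _ _ _ _
    _ ≤ ε / 2 + r + ε / 2 := by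
      gcongr
      · rw [edist_comm]; exact (mem_eball.1 hz').le
      · exact edist_le_of_ediam_le hz'E hy'E (hE n)
      · exact (mem_eball.1 hy').le
    _ = r + ε := by rw [add_right_comm, ENNReal.add_halves, add_comm]

theorem exists_nhds_disjoint_of_notMem_ultraLimit [TopologicalSpace Z] {𝒰 : Ultrafilter ι}
    {E : ι → Set Z} {z : Z} (h : z ∉ ultraLimit 𝒰 E) :
    ∃ V ∈ 𝓝 z, ∀ᶠ n in 𝒰, Disjoint V (E n) := by
  simpa only [ultraLimit, mem_ofPred_eq, not_forall, exists_prop, ← Ultrafilter.eventually_not,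
    not_nonempty_iff_eq_empty, ← disjoint_iff_inter_eq_empty] using h

theorem exists_nhds_forall_disjoint [TopologicalSpace Z] {𝒰 : Ultrafilter ι} {κ : Type*}
    {E : ι → κ → Set Z} (J : Finset κ) {z : Z} (hz : ∀ j ∈ J, z ∉ ultraLimit 𝒰 (E · j)) :
    ∃ V ∈ 𝓝 z, ∀ᶠ n in 𝒰, ∀ j ∈ J, Disjoint V (E n j) := by
  choose! V hV hVE using fun j hj => exists_nhds_disjoint_of_notMem_ultraLimit (hz j hj)
  refine ⟨⋂ j ∈ J, V j, (biInter_finset_mem J).2 hV, ?_⟩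
  filter_upwards [(eventually_all_finset J).2 hVE] with n hn j hj
  exact (hn j hj).mono_left (iInter₂_subset j hj)

/-- If infinitely many members of a sequence of small sets meet a fixed one of them, they stay
near it. -/
theorem exists_isWandering_or_subset [PseudoEMetricSpace Z] (𝒰 : Ultrafilter ι) (E : ι → Set Z)
    {r : ℝ≥0∞} (hE : ∀ n, ediam (E n) ≤ r) :
    ∃ D : Set Z, ediam D ≤ 4 * r ∧ (IsWandering 𝒰 E ∨ ∀ᶠ n in 𝒰, E n ⊆ D) := by
  by_cases h : IsWandering 𝒰 E
  · exact ⟨∅, by simp, .inl h⟩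
  simp only [IsWandering, not_forall, ← Ultrafilter.eventually_not, not_disjoint_iff] at h
  obtain ⟨m, hm⟩ := h
  refine ⟨{z | ∃ y ∈ E m, edist z y ≤ r}, ediam_le ?_, .inr ?_⟩
  · rintro z ⟨y, hy, hzy⟩ z' ⟨y', hy', hzy'⟩
    calc edist z z' ≤ edist z y + edist y y' + edist y' z' := edist_triangle4 _ _ _ _
      _ ≤ r + r + r := by
        gcongr
        · exact edist_le_of_ediam_le hy hy' (hE m)
        · rwa [edist_comm]
      _ = 3 * r := by ring
      _ ≤ 4 * r := by gcongr; norm_num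
  · filter_upwards [hm] with n ⟨y, hym, hyn⟩ z hz
    exact ⟨y, hym, edist_le_of_ediam_le hz hyn (hE n)⟩

theorem exists_finset_pairwise_disjoint {𝒰 : Ultrafilter ι} (h𝒰 : (𝒰 : Filter ι) ≤ cofinite)
    {κ : Type*} (E : ι → κ → Set Z) (J : Finset κ) (hJ : ∀ j ∈ J, IsWandering 𝒰 (E · j))
    {G : Set ι} (hG : G ∈ 𝒰) (M : ℕ) :
    ∃ T : Finset ι, T.card = M ∧ ↑T ⊆ G ∧
      ∀ j ∈ J, (T : Set ι).PairwiseDisjoint (E · j) := by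
  classical
  induction M with
  | zero => exact ⟨∅, by simp⟩
  | succ M ih =>
    obtain ⟨T, hcard, hTG, hT⟩ := ih
    have hdisj : ∀ᶠ n in 𝒰, ∀ m ∈ T, ∀ j ∈ J, Disjoint (E m j) (E n j) :=
      (eventually_all_finset T).2 fun m _ => (eventually_all_finset J).2 fun j hj => hJ j hj m
    have hnew : ∀ᶠ n in 𝒰, n ∉ T := h𝒰 T.finite_toSet.compl_mem_cofinite
    obtain ⟨n, hn, hnT, hnG⟩ := (hdisj.and (hnew.and hG)).exists
    refine ⟨insert n T, by rw [Finset.card_insert_of_notMem hnT, hcard], ?_, fun j hj => ?_⟩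
    · rw [Finset.coe_insert]
      exact insert_subset hnG hTG
    · rw [Finset.coe_insert]
      exact (hT j hj).insert fun m hm _ => (hn m hm j hj).symm

theorem card_filter_exists_mem_le {κ : Type*} {T : Finset ι} {J : Finset κ} {E : ι → κ → Set Z}
    (hE : ∀ j ∈ J, (T : Set ι).PairwiseDisjoint (E · j)) (z : Z)
    [DecidablePred fun n => ∃ j ∈ J, z ∈ E n j] :
    (T.filter fun n => ∃ j ∈ J, z ∈ E n j).card ≤ J.card := by
  refine Finset.card_le_card_of_forall_subsingleton (fun n j => z ∈ E n j)
    (fun n hn => (Finset.mem_filter.1 hn).2) fun j hj m ⟨hm, hzm⟩ n ⟨hn, hzn⟩ => ?_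
  exact (hE j hj).elim_set (Finset.mem_filter.1 hm).1 (Finset.mem_filter.1 hn).1 z hzm hzn

/-- Averaging over many of the coverings makes the wandering sets dispensable: each point lies in
few of them, hence in the carriers of most of the families. -/
theorem mul_dyadicContent_le_of_isWandering [PseudoEMetricSpace Z] {𝒰 : Ultrafilter ι}
    (h𝒰 : (𝒰 : Filter ι) ≤ cofinite) {x y b : ℝ≥0∞} (hy : y ≠ 0) (hyx : y < x) (hx : x ≠ ⊤)
    {F : ι → DyadicFamily Z} (hF : ∀ n, (F n).pieces 0 = ∅) (hcost : ∀ n, (F n).cost x ≤ b)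
    {κ : Type*} {E : ι → κ → Set Z} {J : Finset κ} (hJ : ∀ j ∈ J, IsWandering 𝒰 (E · j))
    {S : Set Z} (hS : ∀ᶠ n in 𝒰, S ⊆ (F n).carrier ∪ ⋃ j ∈ J, E n j) :
    (1 - y / x) / 2 * (y * dyadicContent y S) ≤ 2 * b := by
  classical
  obtain ⟨T, hTcard, hTG, hT⟩ := exists_finset_pairwise_disjoint h𝒰 E J hJ hS (2 * J.card + 1)
  set c : ℝ≥0∞ := ((J.card + 1 : ℕ) : ℝ≥0∞) with hc
  have hc0 : c ≠ 0 := by simp [hc]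
  have hctop : c ≠ ⊤ := ENNReal.natCast_ne_top _
  have hcover : ∀ z ∈ S, 1 ≤ ∑' n : T, (F n).carrier.indicator (fun _ => c⁻¹) z := fun z hz => by
    have hbad := card_filter_exists_mem_le hT z
    have hgood : J.card + 1 ≤ (T.filter fun n => ¬ ∃ j ∈ J, z ∈ E n j).card := by
      have := Finset.card_filter_add_card_filter_not (s := T) fun n => ∃ j ∈ J, z ∈ E n j
      omega
    calc (1 : ℝ≥0∞) = c * c⁻¹ := (ENNReal.mul_inv_cancel hc0 hctop).symm
      _ ≤ (T.filter fun n => ¬ ∃ j ∈ J, z ∈ E n j).card * c⁻¹ := by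
        gcongr
        exact hc ▸ Nat.cast_le.2 hgood
      _ = ∑ n ∈ T.filter fun n => ¬ ∃ j ∈ J, z ∈ E n j,
          (F n).carrier.indicator (fun _ => c⁻¹) z := by
        rw [← nsmul_eq_mul, ← Finset.sum_const]
        refine Finset.sum_congr rfl fun n hn => ?_
        obtain ⟨hnT, hnz⟩ := Finset.mem_filter.1 hn
        rw [indicator_of_mem ((hTG hnT hz).resolve_right (by simpa using hnz))]
      _ ≤ ∑ n ∈ T, (F n).carrier.indicator (fun _ => c⁻¹) z :=
        Finset.sum_le_sum_of_subset (Finset.filter_subset _ _)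
      _ = _ := by rw [← Finset.sum_coe_sort, tsum_fintype]
  calc (1 - y / x) / 2 * (y * dyadicContent y S)
      ≤ ∑' n : T, c⁻¹ * (F n).cost x :=
        mul_dyadicContent_le_tsum_cost hy hyx hx _ (fun n : T => F n) (fun n => hF n) hcover
    _ ≤ ∑' _ : T, c⁻¹ * b := by gcongr; exact hcost _
    _ = (2 * J.card + 1 : ℕ) * (c⁻¹ * b) := by simp [hTcard]
    _ ≤ (2 * c) * (c⁻¹ * b) := by
      gcongr
      rw [hc]
      exact_mod_cast (by omega : 2 * J.card + 1 ≤ 2 * (J.card + 1))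
    _ = 2 * b := by
      rw [mul_assoc, ← mul_assoc c, ENNReal.mul_inv_cancel hc0 hctop, one_mul]

end Wandering

namespace DyadicFamily

variable {Z : Type*} [PseudoEMetricSpace Z]

/-- The part of a dyadic family at scales `k ≥ K`. -/
def tail (F : DyadicFamily Z) (K : ℕ) : DyadicFamily Z where
  pieces k := if K ≤ k then F.pieces k else ∅
  ediam_le k E hE := by
    split_ifs at hE
    · exact F.ediam_le k E hE
    · simp at hE

theorem pieces_tail_of_le (F : DyadicFamily Z) {K k : ℕ} (hk : K ≤ k) :
    (F.tail K).pieces k = F.pieces k := if_pos hk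

theorem cost_tail_le (F : DyadicFamily Z) (K : ℕ) {q : ℝ≥0∞} (hq : q ≤ 1) (x : ℝ≥0∞) :
    (F.tail K).cost (q * x) ≤ q ^ K * F.cost x := by
  rw [cost, cost, ← ENNReal.tsum_mul_left]
  refine ENNReal.tsum_le_tsum fun k => ?_
  by_cases hk : K ≤ k
  · calc (((F.tail K).pieces k).card : ℝ≥0∞) * (q * x) ^ k
        = q ^ k * ((F.pieces k).card * x ^ k) := by
          rw [F.pieces_tail_of_le hk, mul_pow, mul_left_comm]
      _ ≤ q ^ K * ((F.pieces k).card * x ^ k) := by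
        gcongr ?_ * _
        exact pow_le_pow_right_of_le_one' hq hk
  · simp [tail, hk]

/-- An enumeration of the sets listed at scale `k`, continued by empty sets. -/
noncomputable def piece (F : DyadicFamily Z) (k i : ℕ) : Set Z := (F.pieces k).toList.getD i ∅

theorem ediam_piece_le (F : DyadicFamily Z) (k i : ℕ) : ediam (F.piece k i) ≤ 2⁻¹ ^ k := by
  by_cases hi : i < (F.pieces k).toList.length
  · rw [piece, List.getD_eq_getElem _ _ hi]
    exact F.ediam_le k _ (Finset.mem_toList.1 (List.getElem_mem hi))
  · rw [piece, List.getD_eq_default _ _ (not_lt.1 hi)]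
    simp

theorem exists_mem_piece {F : DyadicFamily Z} {z : Z} (hz : z ∈ F.carrier) :
    ∃ k, ∃ i < (F.pieces k).card, z ∈ F.piece k i ∧ ∀ K ≤ k, z ∈ (F.tail K).carrier := by
  obtain ⟨k, E, hE, hzE⟩ := mem_carrier.1 hz
  obtain ⟨i, hi, rfl⟩ := List.mem_iff_getElem.1 (Finset.mem_toList.2 hE)
  refine ⟨k, i, by simpa using hi, ?_, fun K hK => mem_carrier.2 ⟨k, _, ?_, hzE⟩⟩
  · rwa [piece, List.getD_eq_getElem _ _ hi]
  · rwa [F.pieces_tail_of_le hK]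

end DyadicFamily

section Increasing

variable {Z : Type*}

theorem dyadicContent_le_tsum [PseudoEMetricSpace Z] (x : ℝ≥0∞) {A : Set Z} (N : ℕ → ℕ)
    (E : ℕ → ℕ → Set Z) (hE : ∀ k i, ediam (E k i) ≤ 2⁻¹ ^ k)
    (hA : ∀ z ∈ A, ∃ k, ∃ i < N k, z ∈ E k i) :
    dyadicContent x A ≤ ∑' k, (N k : ℝ≥0∞) * x ^ k := by
  classical
  let F : DyadicFamily Z :=
    { pieces := fun k => (Finset.range (N k)).image (E k)
      ediam_le := fun k => Finset.forall_mem_image.2 fun i _ => hE k i }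
  have hAF : A ⊆ F.carrier := fun z hz => by
    obtain ⟨k, i, hi, hzi⟩ := hA z hz
    exact DyadicFamily.mem_carrier.2
      ⟨k, _, Finset.mem_image_of_mem _ (Finset.mem_range.2 hi), hzi⟩
  refine (dyadicContent_le_cost hAF).trans (ENNReal.tsum_le_tsum fun k => ?_)
  gcongr
  exact Finset.card_image_le.trans_eq (Finset.card_range _)

/-- Sets whose diameters exceed the scale by a factor `4` can be listed two scales earlier. -/
theorem sq_mul_dyadicContent_le_tsum [PseudoEMetricSpace Z] (x : ℝ≥0∞) {A : Set Z} (N : ℕ → ℕ)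
    (D : ℕ → ℕ → Set Z) (hD : ∀ k i, ediam (D k i) ≤ 4 * 2⁻¹ ^ k) {K : ℕ} (hK : 2 ≤ K)
    (hA : ∀ z ∈ A, ∃ k ≥ K, ∃ i < N k, z ∈ D k i) :
    x ^ 2 * dyadicContent x A ≤ ∑' k, (Ici K).indicator (fun k => (N k : ℝ≥0∞) * x ^ k) k := by
  classical
  have hD' (k i : ℕ) : ediam (D (k + 2) i) ≤ 2⁻¹ ^ k := by
    have h4 : (4 : ℝ≥0∞) * 2⁻¹ ^ 2 = 1 := by
      rw [← ENNReal.inv_pow, show (4 : ℝ≥0∞) = 2 ^ 2 by norm_num]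
      exact ENNReal.mul_inv_cancel (by simp) (by simp)
    refine (hD (k + 2) i).trans_eq ?_
    rw [pow_add, mul_left_comm, h4, mul_one]
  have hA' : ∀ z ∈ A, ∃ k, ∃ i < (if K ≤ k + 2 then N (k + 2) else 0), z ∈ D (k + 2) i := by
    intro z hz
    obtain ⟨k, hk, i, hi, hzi⟩ := hA z hz
    obtain ⟨j, rfl⟩ := Nat.exists_eq_add_of_le' (hK.trans hk)
    exact ⟨j, i, by rwa [if_pos hk], hzi⟩
  calc x ^ 2 * dyadicContent x A
      ≤ x ^ 2 * ∑' k, ((if K ≤ k + 2 then N (k + 2) else 0 : ℕ) : ℝ≥0∞) * x ^ k := by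
        gcongr
        exact dyadicContent_le_tsum x _ _ hD' hA'
    _ = ∑' k, (Ici K).indicator (fun k => (N k : ℝ≥0∞) * x ^ k) (k + 2) := by
        rw [← ENNReal.tsum_mul_left]
        refine tsum_congr fun k => ?_
        by_cases hk : K ≤ k + 2
        · rw [if_pos hk, indicator_of_mem (mem_Ici.2 hk)]
          ring
        · simp [hk]
    _ ≤ _ := ENNReal.tsum_comp_le_tsum_of_injective (add_left_injective 2)
        ((Ici K).indicator fun k => (N k : ℝ≥0∞) * x ^ k)

theorem tendsto_tsum_indicator_Ici {f : ℕ → ℝ≥0∞} (hf : ∑' k, f k ≠ ⊤) :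
    Tendsto (fun K => ∑' k, (Ici K).indicator f k) atTop (𝓝 0) := by
  refine (ENNReal.tendsto_sum_nat_add f hf).congr fun K => ?_
  rw [← (ENNReal.summable (f := fun k => (Ici K).indicator f (k + K))).sum_add_tsum_nat_add',
    Finset.sum_eq_zero fun k hk => indicator_of_notMem (by simpa using hk) f, zero_add]
  exact tsum_congr fun k => by simp

theorem exists_limit_card [PseudoEMetricSpace Z] {ι : Type*} (𝒰 : Ultrafilter ι) {x b : ℝ≥0∞}
    (hx : x ≠ 0) (hb : b ≠ ⊤) {F : ι → DyadicFamily Z} (hF : ∀ n, (F n).cost x ≤ b) :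
    ∃ N : ℕ → ℕ, (∀ K, ∀ᶠ n in 𝒰, ∀ k < K, ((F n).pieces k).card = N k) ∧
      ∑' k, (N k : ℝ≥0∞) * x ^ k ≤ b := by
  have hconst (k : ℕ) : ∃ c, ∀ᶠ n in 𝒰, ((F n).pieces k).card = c := by
    obtain ⟨M, hM⟩ := ENNReal.exists_nat_gt (ENNReal.div_ne_top hb (pow_ne_zero k hx))
    have hle (n : ι) : ((F n).pieces k).card ≤ M := by
      have : (((F n).pieces k).card : ℝ≥0∞) ≤ b / x ^ k := by
        rw [ENNReal.le_div_iff_mul_le (.inl (pow_ne_zero k hx)) (.inr hb)]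
        exact (ENNReal.le_tsum k).trans (hF n)
      exact_mod_cast (this.trans_lt hM).le
    obtain ⟨c, -, hc⟩ := (Ultrafilter.eventually_exists_mem_iff (finite_Iic M)).1
      (Eventually.of_forall fun n => ⟨_, hle n, rfl⟩ : ∀ᶠ n in 𝒰, ∃ c ∈ Iic M, _ = c)
    exact ⟨c, hc⟩
  choose N hN using hconst
  have hNK (K : ℕ) : ∀ᶠ n in 𝒰, ∀ k < K, ((F n).pieces k).card = N k :=
    (eventually_all_finite (finite_Iio K)).2 fun k _ => hN k
  refine ⟨N, hNK, ENNReal.tsum_le_of_sum_range_le fun K => ?_⟩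
  obtain ⟨n, hn⟩ := (hNK K).exists
  calc ∑ k ∈ Finset.range K, (N k : ℝ≥0∞) * x ^ k
      = ∑ k ∈ Finset.range K, (((F n).pieces k).card : ℝ≥0∞) * x ^ k :=
        Finset.sum_congr rfl fun k hk => by rw [hn k (Finset.mem_range.1 hk)]
    _ ≤ b := (ENNReal.sum_le_tsum _).trans (hF n)

theorem dyadicContent_eq_zero_of_isWandering [PseudoEMetricSpace Z] {ι κ : Type*}
    {𝒰 : Ultrafilter ι} (h𝒰 : (𝒰 : Filter ι) ≤ cofinite) {x y b : ℝ≥0∞} (hy : y ≠ 0) (hyx : y < x)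
    (hx : x ≠ ⊤) (hb : b ≠ ⊤) {F : ι → DyadicFamily Z} (hF : ∀ n, (F n).cost x ≤ b)
    {E : ι → κ → Set Z} {S : Set Z}
    (hS : ∀ K, ∃ J : Finset κ, (∀ j ∈ J, IsWandering 𝒰 (E · j)) ∧
      ∀ᶠ n in 𝒰, S ⊆ ((F n).tail K).carrier ∪ ⋃ j ∈ J, E n j) :
    dyadicContent y S = 0 := by
  obtain ⟨x', hyx', hx'x⟩ := exists_between hyx
  have hx'top : x' ≠ ⊤ := hx'x.ne_top
  have hx0 : x ≠ 0 := (pos_of_gt hyx).ne'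
  have hq : x' / x < 1 := div_lt_one_of_lt_of_ne_top hx'x hx
  have hbound (K : ℕ) :
      (1 - y / x') / 2 * (y * dyadicContent y S) ≤ 2 * ((x' / x) ^ (K + 1) * b) := by
    obtain ⟨J, hJ, hSJ⟩ := hS (K + 1)
    refine mul_dyadicContent_le_of_isWandering h𝒰 hy hyx' hx'top
      (F := fun n => (F n).tail (K + 1)) (fun n => by simp [DyadicFamily.tail]) (fun n => ?_) hJ hSJ
    calc ((F n).tail (K + 1)).cost x' = ((F n).tail (K + 1)).cost (x' / x * x) := by
          rw [ENNReal.div_mul_cancel hx0 hx]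
      _ ≤ (x' / x) ^ (K + 1) * (F n).cost x := (F n).cost_tail_le _ hq.le x
      _ ≤ _ := by gcongr; exact hF n
  have hlim : Tendsto (fun K : ℕ => 2 * ((x' / x) ^ (K + 1) * b)) atTop (𝓝 0) := by
    have := (ENNReal.tendsto_pow_atTop_nhds_zero_of_lt_one hq).comp (tendsto_add_atTop_nat 1)
    simpa using ENNReal.Tendsto.const_mul (ENNReal.Tendsto.mul_const this (.inr hb))
      (.inr (ENNReal.ofNat_ne_top (n := 2)))
  have hzero : (1 - y / x') / 2 * (y * dyadicContent y S) ≤ 0 :=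
    ge_of_tendsto hlim (Eventually.of_forall hbound)
  simpa [half_one_sub_div_ne_zero hyx' hx'top, hy] using hzero

theorem dimH_le_of_isWandering [EMetricSpace Z] {ι κ : Type*} {𝒰 : Ultrafilter ι}
    (h𝒰 : (𝒰 : Filter ι) ≤ cofinite) {t : ℝ≥0} {b : ℝ≥0∞} (hb : b ≠ ⊤)
    {F : ι → DyadicFamily Z} (hF : ∀ n, (F n).cost (2 ^ (-(t : ℝ))) ≤ b)
    {E : ι → κ → Set Z} {S : Set Z}
    (hS : ∀ K, ∃ J : Finset κ, (∀ j ∈ J, IsWandering 𝒰 (E · j)) ∧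
      ∀ᶠ n in 𝒰, S ⊆ ((F n).tail K).carrier ∪ ⋃ j ∈ J, E n j) :
    dimH S ≤ t := by
  refine le_of_forall_gt_imp_ge_of_dense fun s hs => ?_
  obtain ⟨u, htu, hus⟩ := ENNReal.lt_iff_exists_nnreal_btwn.1 hs
  have htu' : t < u := by exact_mod_cast htu
  refine (dimH_le_of_dyadicContent_eq_zero (pos_of_gt htu') ?_).trans hus.le
  exact dyadicContent_eq_zero_of_isWandering h𝒰 (two_rpow_ne_zero _)
    (ENNReal.rpow_lt_rpow_of_exponent_lt (by norm_num) (by simp) (by simpa using htu'))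
    (two_rpow_ne_top _) hb hF hS

theorem dimH_le_of_isWandering_or_disjoint [EMetricSpace Z] {ι : Type*} {𝒰 : Ultrafilter ι}
    (h𝒰 : (𝒰 : Filter ι) ≤ cofinite) {t : ℝ≥0} {b : ℝ≥0∞} (hb : b ≠ ⊤)
    {F : ι → DyadicFamily Z} (hF : ∀ n, (F n).cost (2 ^ (-(t : ℝ))) ≤ b) {N : ℕ → ℕ}
    (hN : ∀ K, ∀ᶠ n in 𝒰, ∀ k < K, ((F n).pieces k).card = N k) {S : Set Z}
    (hSF : ∀ᶠ n in 𝒰, S ⊆ (F n).carrier)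
    (hS : ∀ k, ∀ i < N k, IsWandering 𝒰 (fun n => (F n).piece k i) ∨
      ∀ᶠ n in 𝒰, Disjoint S ((F n).piece k i)) :
    dimH S ≤ t := by
  classical
  refine dimH_le_of_isWandering h𝒰 hb hF (E := fun n (p : Σ _ : ℕ, ℕ) => (F n).piece p.1 p.2)
    fun K => ?_
  let I : Finset (Σ _ : ℕ, ℕ) := (Finset.range K).sigma fun k => Finset.range (N k)
  refine ⟨I.filter fun p => IsWandering 𝒰 fun n => (F n).piece p.1 p.2,
    fun p hp => (Finset.mem_filter.1 hp).2, ?_⟩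
  have hI : ∀ᶠ n in 𝒰, ∀ p ∈ I, (IsWandering 𝒰 fun n => (F n).piece p.1 p.2) ∨
      Disjoint S ((F n).piece p.1 p.2) := by
    refine (eventually_all_finset I).2 fun p hp => ?_
    obtain hw | hd := hS p.1 p.2 (Finset.mem_range.1 (Finset.mem_sigma.1 hp).2)
    · exact Eventually.of_forall fun n => .inl hw
    · exact hd.mono fun n => .inr
  filter_upwards [hSF, hN K, hI] with n hn hNn hIn z hz
  obtain ⟨k, i, hi, hzi, htail⟩ := DyadicFamily.exists_mem_piece (hn hz)
  by_cases hk : K ≤ k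
  · exact .inl (htail K hk)
  have hkK : k < K := not_le.1 hk
  have hp : (⟨k, i⟩ : Σ _ : ℕ, ℕ) ∈ I :=
    Finset.mem_sigma.2 ⟨Finset.mem_range.2 hkK, Finset.mem_range.2 (hNn k hkK ▸ hi)⟩
  have hw := (hIn _ hp).resolve_right (not_disjoint_iff.2 ⟨z, hz, hzi⟩)
  exact .inr (mem_biUnion (Finset.mem_filter.2 ⟨hp, hw⟩) hzi)

theorem dimH_iUnion_sdiff_le [EMetricSpace Z] [SecondCountableTopology Z] {t : ℝ≥0} {b : ℝ≥0∞}
    (hb : b ≠ ⊤) {F : ℕ → DyadicFamily Z} (hF : ∀ n, (F n).cost (2 ^ (-(t : ℝ))) ≤ b) {N : ℕ → ℕ}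
    (hN : ∀ K, ∀ᶠ n in hyperfilter ℕ, ∀ k < K, ((F n).pieces k).card = N k) {A : ℕ → Set Z}
    (hA : Monotone A) (hAF : ∀ n, A n ⊆ (F n).carrier) {k₀ : ℕ} {D : ℕ → ℕ → Set Z}
    (hD : ∀ k i, IsWandering (hyperfilter ℕ) (fun n => (F n).piece k i) ∨
      ∀ᶠ n in hyperfilter ℕ, (F n).piece k i ⊆ D k i) :
    dimH ((⋃ n, A n) \
      ({z | ∃ k, ∃ i < N k, z ∈ ultraLimit (hyperfilter ℕ) fun n => (F n).piece k i} ∪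
        {z | ∃ k ≥ k₀, ∃ i < N k, z ∈ D k i})) ≤ t := by
  by_contra! hdim
  obtain ⟨z, ⟨-, hzB⟩, hz⟩ := exists_mem_nhdsWithin_lt_dimH_of_lt_dimH hdim
  let I : Finset (Σ _ : ℕ, ℕ) := (Finset.range k₀).sigma fun k => Finset.range (N k)
  have hI {k i : ℕ} : ⟨k, i⟩ ∈ I ↔ k < k₀ ∧ i < N k := by simp [I]
  have hzI : ∀ p ∈ I, z ∉ ultraLimit (hyperfilter ℕ) fun n => (F n).piece p.1 p.2 :=
    fun p hp hzp => hzB (.inl ⟨p.1, p.2, (hI.1 hp).2, hzp⟩)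
  obtain ⟨V, hV, hVF⟩ := exists_nhds_forall_disjoint I hzI
  refine (hz _ (inter_mem_nhdsWithin _ hV)).not_ge ?_
  rw [iUnion_sdiff, iUnion_inter, dimH_iUnion]
  refine iSup_le fun m => dimH_le_of_isWandering_or_disjoint hyperfilter_le_cofinite hb
    hF hN ?_ fun k i hi => ?_
  · filter_upwards [Nat.hyperfilter_le_atTop (eventually_ge_atTop m)] with n hn z hz
    exact hAF n (hA hn hz.1.1)
  · by_cases hk : k < k₀
    · right
      filter_upwards [hVF] with n hn using
        (hn ⟨k, i⟩ (hI.2 ⟨hk, hi⟩)).mono_left inter_subset_right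
    · refine (hD k i).imp_right fun hD => hD.mono fun n hn => disjoint_left.2 fun z hz hzn => ?_
      exact hz.1.2 (.inr ⟨k, not_lt.1 hk, i, hi, hn hzn⟩)

theorem exists_dyadicContent_le_dimH_sdiff_le [EMetricSpace Z] [SecondCountableTopology Z] {t : ℝ≥0}
    {A : ℕ → Set Z} (hA : Monotone A) {b ε : ℝ≥0∞} (hb : b ≠ ⊤) (hε : ε ≠ 0)
    (hAb : ∀ n, dyadicContent (2 ^ (-(t : ℝ))) (A n) < b) :
    ∃ B : Set Z, dyadicContent (2 ^ (-(t : ℝ))) B ≤ b + ε ∧ dimH ((⋃ n, A n) \ B) ≤ t := by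
  set x : ℝ≥0∞ := 2 ^ (-(t : ℝ))
  have hx2 : x ^ 2 ≠ 0 := pow_ne_zero _ (two_rpow_ne_zero _)
  choose F hFA hFb using fun n => exists_cost_lt_of_dyadicContent_lt (hAb n)
  obtain ⟨N, hN, hNb⟩ :=
    exists_limit_card (hyperfilter ℕ) (two_rpow_ne_zero _) hb fun n => (hFb n).le
  choose D hD hFD using fun k i => exists_isWandering_or_subset (hyperfilter ℕ)
    (fun n => (F n).piece k i) fun n => (F n).ediam_piece_le k i
  obtain ⟨k₀, htail, hk₀⟩ : ∃ k₀,
      ∑' k, (Ici k₀).indicator (fun k => (N k : ℝ≥0∞) * x ^ k) k < x ^ 2 * ε ∧ 2 ≤ k₀ :=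
    (((tendsto_tsum_indicator_Ici (ne_top_of_le_ne_top hb hNb)).eventually_lt_const
      (pos_iff_ne_zero.2 (mul_ne_zero hx2 hε))).and (eventually_ge_atTop 2)).exists
  refine ⟨_, (dyadicContent_union_le _ _ _).trans (add_le_add ?_ ?_),
    dimH_iUnion_sdiff_le hb (fun n => (hFb n).le) hN hA hFA hFD (k₀ := k₀)⟩
  · exact (dyadicContent_le_tsum x N _
      (fun k i => ediam_ultraLimit_le fun n => (F n).ediam_piece_le k i) fun z hz => hz).trans hNb
  · rw [← ENNReal.mul_le_mul_iff_right hx2 (ENNReal.pow_ne_top (two_rpow_ne_top _))]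
    exact (sq_mul_dyadicContent_le_tsum x N D hD hk₀ fun z hz => hz).trans htail.le

end Increasing

section ContentMod

variable {Z : Type*} [EMetricSpace Z] {t : ℝ≥0} {A : Set Z}

/-- The `t`-dimensional dyadic content modulo sets of dimension at most `t`. Unlike the content
itself it is continuous along increasing sequences of sets, as Choquet's theorem requires. -/
noncomputable def dyadicContentMod (t : ℝ≥0) (A : Set Z) : ℝ≥0∞ :=
  ⨅ (S : Set Z) (_ : dimH S ≤ t), dyadicContent (2 ^ (-(t : ℝ))) (A \ S)

theorem dyadicContentMod_le {S : Set Z} (hS : dimH S ≤ t) :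
    dyadicContentMod t A ≤ dyadicContent (2 ^ (-(t : ℝ))) (A \ S) :=
  iInf₂_le S hS

theorem dyadicContentMod_le_dyadicContent :
    dyadicContentMod t A ≤ dyadicContent (2 ^ (-(t : ℝ))) A := by
  simpa only [sdiff_empty] using dyadicContentMod_le (t := t) (A := A) (S := ∅) (by simp)

theorem exists_dyadicContent_sdiff_lt {a : ℝ≥0∞} (h : dyadicContentMod t A < a) :
    ∃ S : Set Z, dimH S ≤ t ∧ dyadicContent (2 ^ (-(t : ℝ))) (A \ S) < a := by
  simpa only [dyadicContentMod, iInf_lt_iff, exists_prop] using h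

theorem dyadicContentMod_mono : Monotone (dyadicContentMod t : Set Z → ℝ≥0∞) := fun _ _ h =>
  iInf₂_mono fun _ _ => dyadicContent_mono _ (sdiff_subset_sdiff_left h)

theorem dyadicContentMod_iUnion_le [SecondCountableTopology Z] {A : ℕ → Set Z} (hA : Monotone A) :
    dyadicContentMod t (⋃ n, A n) ≤ ⨆ n, dyadicContentMod t (A n) := by
  refine ENNReal.le_of_forall_pos_le_add fun ε hε ha => ?_
  set a : ℝ≥0∞ := ⨆ n, dyadicContentMod t (A n)
  have hε2 : (ε / 2 : ℝ≥0∞) ≠ 0 := by simpa using hε.ne'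
  choose S hS hSa using fun n => exists_dyadicContent_sdiff_lt
    ((le_iSup (fun n => dyadicContentMod t (A n)) n).trans_lt (ENNReal.lt_add_right ha.ne hε2))
  obtain ⟨B, hB, hBdim⟩ := exists_dyadicContent_le_dimH_sdiff_le
    (A := fun n => A n \ ⋃ m, S m) (fun m n hmn => sdiff_subset_sdiff_left (hA hmn))
    (b := a + ε / 2) (by finiteness) hε2 fun n =>
      (dyadicContent_mono _ (sdiff_subset_sdiff_right (subset_iUnion S n))).trans_lt (hSa n)
  rw [← iUnion_sdiff] at hBdim
  have hdim : dimH ((⋃ m, S m) ∪ ((⋃ n, A n) \ ⋃ m, S m) \ B) ≤ t := by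
    rw [dimH_union, dimH_iUnion]
    exact max_le (iSup_le hS) hBdim
  calc dyadicContentMod t (⋃ n, A n)
      ≤ dyadicContent (2 ^ (-(t : ℝ))) B := by
        refine (dyadicContentMod_le hdim).trans (dyadicContent_mono _ fun z hz => ?_)
        by_contra hzB
        exact hz.2 (or_iff_not_imp_left.2 fun hzS => ⟨⟨hz.1, hzS⟩, hzB⟩)
    _ ≤ a + ε / 2 + ε / 2 := hB
    _ = a + ε := by rw [add_assoc, ENNReal.add_halves]

theorem dyadicContentMod_pos (ht : 0 < t) (hA : t < dimH A) : 0 < dyadicContentMod t A := by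
  by_contra! h0
  choose S hS hSA using fun n : ℕ => exists_dyadicContent_sdiff_lt
    (h0.trans_lt (ENNReal.inv_pos.2 (ENNReal.natCast_ne_top n)))
  have hzero : dyadicContent (2 ^ (-(t : ℝ))) (A \ ⋃ n, S n) = 0 :=
    nonpos_iff_eq_zero.1 (ge_of_tendsto' ENNReal.tendsto_inv_nat_nhds_zero fun n =>
      (dyadicContent_mono _ (sdiff_subset_sdiff_right (subset_iUnion S n))).trans (hSA n).le)
  refine hA.not_ge ?_
  calc dimH A ≤ dimH ((A \ ⋃ n, S n) ∪ ⋃ n, S n) := dimH_mono (by simp)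
    _ ≤ t := by
      rw [dimH_union, dimH_iUnion]
      exact max_le (dimH_le_of_dyadicContent_eq_zero ht hzero) (iSup_le hS)

end ContentMod

section Choquet

theorem isCompact_setOf_forall_le (σ : ℕ → ℕ) : IsCompact {z : ℕ → ℕ | ∀ i, z i ≤ σ i} := by
  convert isCompact_univ_pi fun i => (finite_Iic (σ i)).isCompact
  ext z
  simp [Pi.le_def]

theorem exists_setOf_forall_lt_subset_of_isOpen (σ : ℕ → ℕ) {U : Set (ℕ → ℕ)} (hU : IsOpen U)
    (h : {z : ℕ → ℕ | ∀ i, z i ≤ σ i} ⊆ U) : ∃ k, {z : ℕ → ℕ | ∀ i < k, z i ≤ σ i} ⊆ U := by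
  by_contra! hcon
  choose z hz hzU using fun k => not_subset.1 (hcon k)
  obtain ⟨y, hy, φ, hφ, hlim⟩ := (isCompact_setOf_forall_le σ).tendsto_subseq
    (x := fun k i => min (z k i) (σ i)) fun k i => min_le_right _ _
  have hzy : Tendsto (fun k => z (φ k)) atTop (𝓝 y) := by
    rw [tendsto_pi_nhds] at hlim ⊢
    refine fun i => (hlim i).congr' ?_
    filter_upwards [eventually_gt_atTop i] with k hk
    exact min_eq_left (hz (φ k) i (hk.trans_le (hφ.id_le k)))
  obtain ⟨k, hk⟩ := (hzy.eventually (hU.mem_nhds (h hy))).exists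
  exact hzU (φ k) hk

variable {Z β : Type*} [CompleteLinearOrder β] {c : Set Z → β} {a : β}

theorem exists_bound_forall_lt (hc : ∀ A : ℕ → Set Z, Monotone A → c (⋃ n, A n) ≤ ⨆ n, c (A n))
    (f : (ℕ → ℕ) → Z) (ha : a < c (range f)) :
    ∃ σ : ℕ → ℕ, ∀ k, a < c (f '' {z | ∀ i < k, z i ≤ σ i}) := by
  have step (k : ℕ) (C : {C : Set (ℕ → ℕ) // a < c (f '' C)}) :
      ∃ n, a < c (f '' (C.1 ∩ {z | z k ≤ n})) := by
    have hC : C.1 = ⋃ n, C.1 ∩ {z | z k ≤ n} := by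
      rw [← inter_iUnion, eq_comm, inter_eq_left]
      exact fun z _ => mem_iUnion.2 ⟨z k, le_refl (z k)⟩
    refine lt_iSup_iff.1 (C.2.trans_le ?_)
    conv_lhs => rw [hC, image_iUnion]
    exact hc _ fun m n hmn => image_mono (inter_subset_inter_right _ fun z hz => le_trans hz hmn)
  choose n hn using step
  let C (k : ℕ) : {C : Set (ℕ → ℕ) // a < c (f '' C)} :=
    Nat.rec ⟨univ, by rwa [image_univ]⟩ (fun k C => ⟨C.1 ∩ {z | z k ≤ n k C}, hn k C⟩) k
  have hC (k : ℕ) : (C k).1 = {z | ∀ i < k, z i ≤ n i (C i)} := by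
    induction k with
    | zero => simp [C]
    | succ k ih =>
      rw [show (C (k + 1)).1 = (C k).1 ∩ {z | z k ≤ n k (C k)} from rfl, ih]
      ext z
      simp only [mem_inter_iff, mem_ofPred_eq, Nat.forall_lt_succ_right]
  exact ⟨fun k => n k (C k), fun k => hC k ▸ (C k).2⟩

/-- **Choquet's capacitability theorem**, for compact sets approximated by their open
neighbourhoods: `c` need not be continuous along decreasing sequences of compact sets. -/
theorem exists_isCompact_forall_isOpen_lt [TopologicalSpace Z] (hmono : Monotone c)
    (hc : ∀ A : ℕ → Set Z, Monotone A → c (⋃ n, A n) ≤ ⨆ n, c (A n)) {X : Set Z}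
    (hX : AnalyticSet X) (ha : a < c X) :
    ∃ K ⊆ X, IsCompact K ∧ ∀ W, IsOpen W → K ⊆ W → a < c W := by
  rw [AnalyticSet] at hX
  obtain rfl | ⟨f, hf, rfl⟩ := hX
  · exact ⟨∅, Subset.rfl, isCompact_empty, fun W _ hW => ha.trans_le (hmono hW)⟩
  obtain ⟨σ, hσ⟩ := exists_bound_forall_lt hc f ha
  refine ⟨f '' {z | ∀ i, z i ≤ σ i}, image_subset_range _ _,
    (isCompact_setOf_forall_le σ).image hf, fun W hW hKW => ?_⟩
  obtain ⟨k, hk⟩ :=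
    exists_setOf_forall_lt_subset_of_isOpen σ (hW.preimage hf) (image_subset_iff.1 hKW)
  exact (hσ k).trans_le (hmono (image_subset_iff.2 hk))

end Choquet

section Duality

open CompactlySupported CompactlySupportedContinuousMap

variable {K I : Type*} [TopologicalSpace K] [CompactSpace K]

/-- Duality of linear programming: the functional extends `r • 1 ↦ r` and is nonnegative on the
cone of the functions that dominate a combination of the differences `c p - u p`. -/
theorem exists_positiveLinearMap_le {u : I → K → ℝ≥0} {c : I → ℝ≥0}
    (h : ∀ w : I →₀ ℝ≥0, ∃ z,
      Finsupp.linearCombination ℝ≥0 u w z ≤ Finsupp.linearCombination ℝ≥0 c w) :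
    ∃ L : C_c(K, ℝ) →ₚ[ℝ] ℝ, L (continuousMapEquiv 1) = 1 ∧
      ∀ p, ∀ g : C_c(K, ℝ), (∀ z, g z ≤ u p z) → L g ≤ c p := by
  let one : C_c(K, ℝ) := continuousMapEquiv 1
  have hone (z : K) : one z = 1 := rfl
  have hone0 : one ≠ 0 := fun h0 => by
    obtain ⟨z, -⟩ := h 0
    simpa [hone] using DFunLike.congr_fun h0 z
  let cone : PointedCone ℝ C_c(K, ℝ) :=
    { carrier := {g | ∃ w : I →₀ ℝ≥0, ∀ z,
        (Finsupp.linearCombination ℝ≥0 c w : ℝ) ≤ g z + Finsupp.linearCombination ℝ≥0 u w z}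
      zero_mem' := ⟨0, fun z => by simp⟩
      smul_mem' := fun r g ⟨w, hw⟩ => ⟨Real.toNNReal r • w, fun z => by
        simpa [mul_add, r.2, show r • g z = r.1 * g z from rfl] using
          mul_le_mul_of_nonneg_left (hw z) r.2⟩
      add_mem' := fun {g g'} ⟨w, hw⟩ ⟨w', hw'⟩ => ⟨w + w', fun z => by
        simpa [add_add_add_comm] using add_le_add (hw z) (hw' z)⟩ }
  obtain ⟨L, hL1, hL⟩ := riesz_extension cone (LinearPMap.mkSpanSingleton one 1 hone0)
    (by
      rintro ⟨_, hf⟩ ⟨w, hw⟩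
      obtain ⟨r, rfl⟩ := Submodule.mem_span_singleton.1 hf
      obtain ⟨z, hz⟩ := h w
      have hr : (Finsupp.linearCombination ℝ≥0 c w : ℝ) ≤
          r + Finsupp.linearCombination ℝ≥0 u w z := by simpa [hone] using hw z
      have hr0 : 0 ≤ r := by linarith [NNReal.coe_le_coe.2 hz]
      rw [LinearPMap.mkSpanSingleton'_apply]
      simpa using hr0)
    (fun g => by
      obtain ⟨M, hM⟩ := isCompact_univ.bddBelow_image g.continuous.continuousOn
      refine ⟨⟨-M • one, Submodule.smul_mem _ _ (Submodule.mem_span_singleton_self one)⟩, 0,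
        fun z => ?_⟩
      simpa [hone] using hM (mem_image_of_mem g (mem_univ z)))
  have hLone : L one = 1 := (hL1 ⟨one, Submodule.mem_span_singleton_self one⟩).trans
    (LinearPMap.mkSpanSingleton_apply ℝ ℝ hone0 1)
  refine ⟨PositiveLinearMap.mk₀ L fun g hg => hL g ⟨0, fun z => by simpa using hg z⟩, hLone,
    fun p g hg => ?_⟩
  change L g ≤ c p
  have := hL ((c p : ℝ) • one - g) ⟨Finsupp.single p 1, fun z => by simp [hone]; linarith [hg z]⟩
  simpa [hLone] using this

theorem exists_isProbabilityMeasure_le [T2Space K] [MeasurableSpace K] [BorelSpace K]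
    {U : I → Set K} (hU : ∀ p, IsOpen (U p)) {c : I → ℝ≥0}
    (h : ∀ w : I →₀ ℝ≥0, ∃ z, Finsupp.linearCombination ℝ≥0 (fun p => (U p).indicator 1) w z ≤
      Finsupp.linearCombination ℝ≥0 c w) :
    ∃ μ : Measure K, IsProbabilityMeasure μ ∧ ∀ p, μ (U p) ≤ c p := by
  obtain ⟨L, hL1, hL⟩ := exists_positiveLinearMap_le h
  refine ⟨RealRMK.rieszMeasure L, ?_, fun p => ?_⟩
  · have hmass := RealRMK.integral_rieszMeasure L (continuousMapEquiv 1)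
    rw [hL1] at hmass
    exact isProbabilityMeasure_iff_real.2 (by simpa using hmass)
  · rw [(hU p).measure_eq_iSup_isCompact]
    refine iSup₂_le fun C hCU => iSup_le fun hC => ?_
    obtain ⟨f, hfU, hfC, hf⟩ := exists_tsupport_one_of_isOpen_isClosed (hU p)
      isClosed_closure.isCompact hC.isClosed hCU
    refine (RealRMK.rieszMeasure_le_of_eq_one L (f := continuousMapEquiv f)
      (fun z => (hf z).1) hC (fun z hz => hfC hz)).trans ?_
    refine ENNReal.ofReal_le_of_le_toReal (hL p _ fun z => ?_)
    change f z ≤ _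
    by_cases hz : z ∈ U p
    · simpa [hz] using (hf z).2
    · simpa [hz] using (image_eq_zero_of_notMem_tsupport fun hz' => hz (hfU hz')).le

end Duality

section Frostman

theorem coe_linearCombination {I : Type*} (c : I → ℝ≥0) (w : I →₀ ℝ≥0) :
    (Finsupp.linearCombination ℝ≥0 c w : ℝ≥0∞) = ∑' p, (w p : ℝ≥0∞) * c p := by
  rw [Finsupp.linearCombination_apply, Finsupp.sum, ENNReal.ofNNReal_finsetSum,
    tsum_eq_sum (s := w.support) fun p hp => by simp [Finsupp.notMem_support_iff.1 hp]]
  simp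

theorem coe_linearCombination_indicator {I K : Type*} (U : I → Set K) (w : I →₀ ℝ≥0) (z : K) :
    (Finsupp.linearCombination ℝ≥0 (fun p => (U p).indicator (1 : K → ℝ≥0)) w z : ℝ≥0∞) =
      ∑' p, (U p).indicator (fun _ => (w p : ℝ≥0∞)) z := by
  classical
  have hz : Finsupp.linearCombination ℝ≥0 (fun p => (U p).indicator (1 : K → ℝ≥0)) w z =
      Finsupp.linearCombination ℝ≥0 (fun p => (U p).indicator (1 : K → ℝ≥0) z) w := by
    simp [Finsupp.linearCombination_apply, Finsupp.sum]
  rw [hz, coe_linearCombination]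
  simp [indicator_apply, apply_ite ((↑) : ℝ≥0 → ℝ≥0∞)]

namespace DyadicFamily

variable {Z : Type*} [PseudoEMetricSpace Z]

/-- The family whose only member is `E`, listed at scale `k`. -/
def single (k : ℕ) (E : Set Z) (hE : ediam E ≤ 2⁻¹ ^ k) : DyadicFamily Z where
  pieces j := if j = k then {E} else ∅
  ediam_le j B hB := by
    split at hB <;> simp_all

variable {k : ℕ} {E : Set Z} (hE : ediam E ≤ 2⁻¹ ^ k)

theorem carrier_single : (single k E hE).carrier = E := by
  ext z
  refine mem_carrier.trans ⟨?_, fun hz => ⟨k, E, by simp [single], hz⟩⟩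
  rintro ⟨j, B, hB, hz⟩
  simp only [single] at hB
  split at hB <;> simp_all

theorem cost_single (x : ℝ≥0∞) : (single k E hE).cost x = x ^ k := by
  rw [cost, tsum_eq_single k fun j hj => by simp [single, hj]]
  simp [single]

end DyadicFamily

theorem exists_mem_tsum_indicator_le {Z ι : Type*} [PseudoEMetricSpace Z] {x y a : ℝ≥0∞}
    (hy : y ≠ 0) (hyx : y < x) (hx : x ≠ ⊤) (ha : a ≠ 0) {K : Set Z}
    (hK : ∀ W, IsOpen W → K ⊆ W → a < dyadicContent y W) (F : ι → DyadicFamily Z)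
    (hF : ∀ i, (F i).pieces 0 = ∅) (hFo : ∀ i, IsOpen (F i).carrier) (w : ι → ℝ≥0∞) :
    ∃ z ∈ K, ∑' i, (F i).carrier.indicator (fun _ => w i) z ≤
      ∑' i, w i * ((F i).cost x / ((1 - y / x) / 2 * (y * a))) := by
  by_contra! hcon
  have hq0 := half_one_sub_div_ne_zero hyx hx
  set q := (1 - y / x) / 2
  have hqtop : q ≠ ⊤ := ENNReal.div_ne_top (ENNReal.sub_ne_top ENNReal.one_ne_top) two_ne_zero
  set r := ∑' i, w i * ((F i).cost x / (q * (y * a)))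
  let W : Set Z := {z | r < ∑' i, (F i).carrier.indicator (fun _ => w i) z}
  have hWo : IsOpen W := (lowerSemicontinuous_tsum fun i =>
    (hFo i).lowerSemicontinuous_indicator zero_le).isOpen_preimage r
  have haW : a < dyadicContent y W := hK W hWo hcon
  have hcover (z : Z) (hz : z ∈ W) : 1 ≤ ∑' i, (F i).carrier.indicator (fun _ => w i / r) z := by
    have hdiv : ∑' i, (F i).carrier.indicator (fun _ => w i / r) z =
        (∑' i, (F i).carrier.indicator (fun _ => w i) z) / r := by
      simp_rw [div_eq_mul_inv, indicator_mul_const, ENNReal.tsum_mul_right]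
    rw [hdiv, ENNReal.le_div_iff_mul_le (.inr (pos_of_gt hz).ne') (.inl hz.ne_top), one_mul]
    exact hz.le
  refine (mul_dyadicContent_le_tsum_cost hy hyx hx _ F hF hcover).not_gt ?_
  calc ∑' i, w i / r * (F i).cost x = r / r * (q * (y * a)) := by
        rw [ENNReal.div_eq_inv_mul, mul_assoc, ← ENNReal.tsum_mul_right, ← ENNReal.tsum_mul_left]
        refine tsum_congr fun i => ?_
        rw [mul_assoc (w i), ENNReal.div_mul_cancel (by positivity)
          (ENNReal.mul_ne_top hqtop (ENNReal.mul_ne_top hyx.ne_top haW.ne_top)),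
          ENNReal.div_eq_inv_mul, mul_assoc]
    _ ≤ q * (y * a) := mul_le_of_le_one_left zero_le ENNReal.div_self_le_one
    _ < q * (y * dyadicContent y W) := by
        rw [ENNReal.mul_lt_mul_iff_right hq0 hqtop, ENNReal.mul_lt_mul_iff_right hy hyx.ne_top]
        exact haW

variable {Z : Type*} [EMetricSpace Z] [MeasurableSpace Z] [BorelSpace Z]

theorem exists_isProbabilityMeasure_eball_le {x y a : ℝ≥0∞} (hy : y ≠ 0) (hyx : y < x) (hx : x ≠ ⊤)
    (ha : a ≠ 0) {K : Set Z} (hKc : IsCompact K)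
    (hK : ∀ W, IsOpen W → K ⊆ W → a < dyadicContent y W) :
    ∃ μ : Measure K, IsProbabilityMeasure μ ∧ ∀ (z : Z) (k : ℕ),
      μ (Subtype.val ⁻¹' eball z (2⁻¹ ^ (k + 2))) ≤ x ^ (k + 1) / ((1 - y / x) / 2 * (y * a)) := by
  have := isCompact_iff_compactSpace.1 hKc
  set θ := (1 - y / x) / 2 * (y * a)
  have hθ : θ ≠ 0 := mul_ne_zero (half_one_sub_div_ne_zero hyx hx) (mul_ne_zero hy ha)
  let F (p : Z × ℕ) : DyadicFamily Z := .single (p.2 + 1) (eball p.1 (2⁻¹ ^ (p.2 + 2))) <|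
    ediam_eball_le.trans_eq <| by
      rw [pow_succ' _ (p.2 + 1), ← mul_assoc, ENNReal.mul_inv_cancel (by simp) (by simp), one_mul]
  have hcarrier (p : Z × ℕ) : (F p).carrier = eball p.1 (2⁻¹ ^ (p.2 + 2)) :=
    DyadicFamily.carrier_single _
  have hcost (p : Z × ℕ) : (F p).cost x / θ = (x ^ (p.2 + 1) / θ).toNNReal := by
    rw [DyadicFamily.cost_single,
      ENNReal.coe_toNNReal (ENNReal.div_ne_top (ENNReal.pow_ne_top hx) hθ)]
  obtain ⟨μ, hμ, hμF⟩ := exists_isProbabilityMeasure_le (K := K)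
    (U := fun p => Subtype.val ⁻¹' (F p).carrier)
    (c := fun p => (x ^ (p.2 + 1) / θ).toNNReal)
    (fun p => by rw [hcarrier]; exact isOpen_eball.preimage continuous_subtype_val) (fun w => by
      obtain ⟨z, hz, hzw⟩ := exists_mem_tsum_indicator_le hy hyx hx ha hK F
        (fun p => by simp [F, DyadicFamily.single]) (fun p => hcarrier p ▸ isOpen_eball)
        fun p => (w p : ℝ≥0∞)
      refine ⟨⟨z, hz⟩, ENNReal.coe_le_coe.1 ?_⟩
      rw [coe_linearCombination_indicator, coe_linearCombination]
      exact hzw.trans_eq (tsum_congr fun p => congrArg _ (hcost p)))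
  refine ⟨μ, hμ, fun z k => ?_⟩
  have := hμF (z, k)
  rwa [← hcost, hcarrier, DyadicFamily.cost_single] at this

theorem exists_frostman_measure [SecondCountableTopology Z] {A : Set Z} (hA : AnalyticSet A)
    {s : ℝ≥0} (hs : s < dimH A) :
    ∃ K ⊆ A, IsCompact K ∧ ∃ μ : Measure Z, IsProbabilityMeasure μ ∧ μ Kᶜ = 0 ∧
      ∃ M ≠ (⊤ : ℝ≥0∞), ∀ z k, μ (eball z (2⁻¹ ^ k)) ≤ M * (2 ^ (-(s : ℝ))) ^ k := by
  obtain ⟨t, hst, htA⟩ := ENNReal.lt_iff_exists_nnreal_btwn.1 hs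
  rw [ENNReal.coe_lt_coe] at hst
  obtain ⟨a, ha, haA⟩ := exists_between (dyadicContentMod_pos (pos_of_gt hst) htA)
  obtain ⟨K, hKA, hKc, hK⟩ := exists_isCompact_forall_isOpen_lt dyadicContentMod_mono
    (fun _ => dyadicContentMod_iUnion_le) hA haA
  set x : ℝ≥0∞ := 2 ^ (-(s : ℝ))
  set y : ℝ≥0∞ := 2 ^ (-(t : ℝ))
  have hyx : y < x :=
    ENNReal.rpow_lt_rpow_of_exponent_lt (by norm_num) (by simp) (by simpa using hst)
  obtain ⟨μ, hμ, hμK⟩ := exists_isProbabilityMeasure_eball_le (two_rpow_ne_zero _) hyx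
    (two_rpow_ne_top _) ha.ne' hKc
    fun W hW hKW => (hK W hW hKW).trans_le dyadicContentMod_le_dyadicContent
  set θ := (1 - y / x) / 2 * (y * a)
  have hθ : θ ≠ 0 := mul_ne_zero (half_one_sub_div_ne_zero hyx (two_rpow_ne_top _))
    (mul_ne_zero (two_rpow_ne_zero _) ha.ne')
  have hx0 : x ≠ 0 := two_rpow_ne_zero _
  refine ⟨K, hKA, hKc, μ.map Subtype.val, Measure.isProbabilityMeasure_map (by fun_prop),
    by simp [Measure.map_apply measurable_subtype_coe hKc.isClosed.measurableSet.compl],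
    1 + x⁻¹ + θ⁻¹ * x⁻¹, by finiteness, fun z k => ?_⟩
  rw [Measure.map_apply measurable_subtype_coe isOpen_eball.measurableSet]
  match k with
  | 0 => simpa [add_assoc] using prob_le_one.trans le_self_add
  | 1 =>
    refine prob_le_one.trans ?_
    rw [pow_one, ← ENNReal.inv_mul_cancel hx0 (two_rpow_ne_top _)]
    gcongr
    exact le_add_self.trans le_self_add
  | k + 2 =>
    calc μ (Subtype.val ⁻¹' eball z (2⁻¹ ^ (k + 2))) ≤ x ^ (k + 1) / θ := hμK z k
      _ = θ⁻¹ * x⁻¹ * x ^ (k + 2) := by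
        rw [pow_succ' _ (k + 1), mul_assoc, ENNReal.inv_mul_cancel_left hx0 (two_rpow_ne_top _),
          ENNReal.div_eq_inv_mul]
      _ ≤ (1 + x⁻¹ + θ⁻¹ * x⁻¹) * x ^ (k + 2) := by
        gcongr
        exact le_add_self

end Frostman

section Energy

theorem exists_inv_two_pow_succ_le_and_lt {a : ℝ≥0∞} (ha : a ≠ 0) (ha1 : a < 1) :
    ∃ k : ℕ, 2⁻¹ ^ (k + 1) ≤ a ∧ a < 2⁻¹ ^ k := by
  have hex : ∃ k : ℕ, (2 : ℝ≥0∞)⁻¹ ^ k ≤ a :=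
    (ENNReal.exists_inv_two_pow_lt ha).imp fun _ => le_of_lt
  classical
  obtain ⟨k, hk⟩ : ∃ k, Nat.find hex = k + 1 := Nat.exists_eq_succ_of_ne_zero fun h0 => by
    simpa [h0, ha1.not_ge] using Nat.find_spec hex
  exact ⟨k, hk ▸ Nat.find_spec hex, not_le.1 (Nat.find_min hex (by lia))⟩

theorem rpow_neg_le_one_add_tsum (a : ℝ≥0∞) {s : ℝ} (hs : 0 < s) :
    a ^ (-s) ≤ 1 + ∑' k : ℕ, (Iio (2⁻¹ ^ k)).indicator (fun _ => (2 ^ s) ^ (k + 1)) a := by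
  rcases le_or_gt 1 a with ha | ha
  · refine le_add_right ?_
    rw [ENNReal.rpow_neg, ENNReal.inv_le_one]
    exact ENNReal.one_le_rpow ha hs
  refine le_add_left ?_
  rcases eq_or_ne a 0 with rfl | ha0
  · refine le_top.trans ?_
    rw [← ENNReal.tsum_const_eq_top_of_ne_zero (α := ℕ) one_ne_zero]
    refine ENNReal.tsum_le_tsum fun k => ?_
    rw [indicator_of_mem (mem_Iio.2 (pos_iff_ne_zero.2 (by simp)))]
    exact one_le_pow₀ (ENNReal.one_le_rpow (by norm_num) hs)
  · obtain ⟨k, hka, hak⟩ := exists_inv_two_pow_succ_le_and_lt ha0 ha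
    refine le_trans ?_ (ENNReal.le_tsum k)
    rw [indicator_of_mem (mem_Iio.2 hak), ENNReal.rpow_neg, ENNReal.inv_le_iff_inv_le]
    refine le_of_eq_of_le ?_ (ENNReal.rpow_le_rpow hka hs.le)
    rw [inv_two_pow_rpow, ENNReal.rpow_neg, ENNReal.inv_pow]

theorem lintegral_rpow_neg_le {Ω : Type*} [MeasurableSpace Ω] (ν : Measure Ω) {W : Ω → ℝ≥0∞}
    (hW : Measurable W) {s τ : ℝ} (hs : 0 < s) {C : ℝ≥0∞}
    (h : ∀ k : ℕ, ν {ω | W ω < 2⁻¹ ^ k} ≤ C * (2 ^ (-τ)) ^ k) :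
    ∫⁻ ω, W ω ^ (-s) ∂ν ≤ ν univ + 2 ^ s * C * (1 - 2 ^ (s - τ))⁻¹ := by
  have hmeas (k : ℕ) : MeasurableSet {ω | W ω < 2⁻¹ ^ k} := hW measurableSet_Iio
  calc ∫⁻ ω, W ω ^ (-s) ∂ν
      ≤ ∫⁻ ω, (1 + ∑' k : ℕ, {ω | W ω < 2⁻¹ ^ k}.indicator (fun _ => (2 ^ s) ^ (k + 1)) ω) ∂ν :=
        lintegral_mono fun ω => rpow_neg_le_one_add_tsum (W ω) hs
    _ = ν univ + ∑' k : ℕ, (2 ^ s) ^ (k + 1) * ν {ω | W ω < 2⁻¹ ^ k} := by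
        rw [lintegral_add_left measurable_const, lintegral_one, lintegral_tsum fun k =>
          (measurable_const.indicator (hmeas k)).aemeasurable]
        simp only [lintegral_indicator_const (hmeas _)]
    _ ≤ ν univ + ∑' k : ℕ, 2 ^ s * C * (2 ^ (s - τ)) ^ k := by
        refine add_le_add_right (ENNReal.tsum_le_tsum fun k => ?_) _
        refine (mul_le_mul_right (h k) _).trans_eq ?_
        rw [sub_eq_add_neg, ENNReal.rpow_add _ _ (by simp) (by simp), mul_pow]
        ring
    _ = _ := by rw [ENNReal.tsum_mul_left, ENNReal.tsum_geometric]

theorem add_two_rpow_mul_inv_one_sub_ne_top {s τ : ℝ} (hsτ : s < τ) {a C : ℝ≥0∞} (ha : a ≠ ⊤)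
    (hC : C ≠ ⊤) : a + 2 ^ s * C * (1 - 2 ^ (s - τ))⁻¹ ≠ ⊤ := by
  have h1 : (2 : ℝ≥0∞) ^ (s - τ) < 1 := neg_sub τ s ▸ two_rpow_neg_lt_one (sub_pos.2 hsτ)
  have h2 := two_rpow_ne_top s
  have h3 := (tsub_pos_of_lt h1).ne'
  finiteness

section MassDistribution

variable {Y : Type*} [EMetricSpace Y] [MeasurableSpace Y] [BorelSpace Y] {ν : Measure Y} {s : ℝ≥0}

theorem le_dimH_of_forall_closedEBall_le {c : ℝ≥0∞} (hc : c ≠ ⊤) {B : Set Y} (hB : ν B ≠ 0)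
    (h : ∀ y ∈ B, ∀ r, ν (closedEBall y r) ≤ c * r ^ (s : ℝ)) : s ≤ dimH B := by
  have hν : c⁻¹ • ν.restrict B ≤ μH[(s : ℝ)] := by
    refine Measure.le_hausdorffMeasure _ _ 1 one_pos fun t _ => ?_
    have hclosure : ν (closure t ∩ B) ≤ c * ediam t ^ (s : ℝ) := by
      rcases (closure t ∩ B).eq_empty_or_nonempty with he | ⟨y, hyt, hyB⟩
      · simp [he]
      · refine (measure_mono fun z hz => ?_).trans (h y hyB (ediam t))
        rw [mem_closedEBall, ← ediam_closure t]
        exact edist_le_ediam_of_mem hz.1 hyt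
    calc (c⁻¹ • ν.restrict B) t ≤ c⁻¹ * ν.restrict B (closure t) := by
          rw [Measure.smul_apply, smul_eq_mul]
          gcongr
          exact subset_closure
      _ ≤ c⁻¹ * (c * ediam t ^ (s : ℝ)) := by
          rw [Measure.restrict_apply isClosed_closure.measurableSet]
          gcongr
      _ ≤ ediam t ^ (s : ℝ) := by
          rw [← mul_assoc]
          exact mul_le_of_le_one_left zero_le (ENNReal.inv_mul_le_one c)
  refine le_dimH_of_hausdorffMeasure_ne_zero fun h0 => hB ?_
  have hzero := nonpos_iff_eq_zero.1 ((hν B).trans h0.le)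
  rw [Measure.smul_apply, smul_eq_mul, mul_eq_zero, Measure.restrict_apply_self] at hzero
  exact hzero.resolve_left (ENNReal.inv_ne_zero.2 hc)

theorem rpow_neg_mul_measure_closedEBall_le (y : Y) (r : ℝ≥0∞) :
    r ^ (-(s : ℝ)) * ν (closedEBall y r) ≤ ∫⁻ z, edist y z ^ (-(s : ℝ)) ∂ν := by
  refine le_trans ?_ (mul_meas_ge_le_lintegral (measurable_edist_right.pow_const _)
    (r ^ (-(s : ℝ))))
  gcongr
  intro z hz
  simp only [mem_ofPred_eq, ENNReal.rpow_neg]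
  exact ENNReal.inv_le_inv.2 (ENNReal.rpow_le_rpow (mem_closedEBall'.1 hz) s.2)

theorem le_dimH_of_lintegral_edist_rpow_neg_ne_top [SecondCountableTopology Y] [SFinite ν]
    {A : Set Y} (hA : ν A ≠ 0)
    (hE : ∫⁻ p, edist p.1 p.2 ^ (-(s : ℝ)) ∂(ν.prod ν) ≠ ⊤) : s ≤ dimH A := by
  have hedist : Measurable fun p : Y × Y => edist p.1 p.2 ^ (-(s : ℝ)) :=
    measurable_edist.pow_const _
  rw [lintegral_prod _ hedist.aemeasurable] at hE
  let potential (y : Y) : ℝ≥0∞ := ∫⁻ z, edist y z ^ (-(s : ℝ)) ∂ν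
  have hmeas : Measurable potential := hedist.lintegral_prod_right'
  obtain ⟨M, hM⟩ : ∃ M : ℕ, ν (A ∩ {y | potential y ≤ M}) ≠ 0 := by
    by_contra! hcon
    refine hA (measure_mono_null_ae ?_ (measure_iUnion_null hcon))
    filter_upwards [ae_lt_top hmeas hE] with y hy hyA
    obtain ⟨M, hM⟩ := ENNReal.exists_nat_gt hy.ne
    exact mem_iUnion.2 ⟨M, hyA, hM.le⟩
  refine (le_dimH_of_forall_closedEBall_le (c := 1 + M) (by finiteness) hM fun y hy r => ?_).trans
    (dimH_mono inter_subset_left)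
  rw [← ENNReal.div_le_iff_le_mul (.inr (by finiteness)) (.inr (by simp)), ENNReal.div_eq_inv_mul,
    ← ENNReal.rpow_neg]
  exact (rpow_neg_mul_measure_closedEBall_le y r).trans (hy.2.trans le_add_self)

theorem le_dimH_range_of_lintegral_edist_rpow_neg_ne_top [SecondCountableTopology Y] {X : Type*}
    [MeasurableSpace X] {μ : Measure X} [SFinite μ] (hμ : μ ≠ 0) {g : X → Y} (hg : Measurable g)
    (hE : ∫⁻ p, edist (g p.1) (g p.2) ^ (-(s : ℝ)) ∂(μ.prod μ) ≠ ⊤) : s ≤ dimH (range g) := by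
  refine le_dimH_of_lintegral_edist_rpow_neg_ne_top (ν := μ.map g) (fun h0 => hμ ?_) ?_
  · have := Measure.le_map_apply hg.aemeasurable (μ := μ) (range g)
    rwa [h0, preimage_range, nonpos_iff_eq_zero, Measure.measure_univ_eq_zero] at this
  · rwa [Measure.map_prod_map _ _ hg hg,
      lintegral_map (measurable_edist.pow_const _) (hg.prodMap hg)]

end MassDistribution

theorem lintegral_edist_rpow_neg_ne_top {X : Type*} [PseudoEMetricSpace X]
    [SecondCountableTopology X] [MeasurableSpace X] [OpensMeasurableSpace X] {μ : Measure X}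
    [IsFiniteMeasure μ] {s u : ℝ} (hs : 0 < s) (hsu : s < u) {M : ℝ≥0∞} (hM : M ≠ ⊤)
    (hμ : ∀ x (k : ℕ), μ (eball x (2⁻¹ ^ k)) ≤ M * (2 ^ (-u)) ^ k) :
    ∫⁻ p, edist p.1 p.2 ^ (-s) ∂(μ.prod μ) ≠ ⊤ := by
  rw [lintegral_prod _ (measurable_edist.pow_const _).aemeasurable]
  have hbound := add_two_rpow_mul_inv_one_sub_ne_top hsu (measure_ne_top μ univ) hM
  refine ne_top_of_le_ne_top (ENNReal.mul_ne_top hbound (measure_ne_top μ univ)) ?_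
  rw [← lintegral_const]
  refine lintegral_mono fun x => lintegral_rpow_neg_le μ measurable_edist_right hs fun k => ?_
  simpa only [eball, edist_comm x] using hμ x k

end Energy

theorem secondCountableTopology_of_analyticSet_univ {X : Type*} [UniformSpace X]
    [IsCountablyGenerated (uniformity X)] (hX : AnalyticSet (univ : Set X)) :
    SecondCountableTopology X := by
  have : TopologicalSpace.SeparableSpace X := by
    rw [AnalyticSet] at hX
    rcases hX with h | ⟨f, hf, hrange⟩
    · have : IsEmpty X := univ_eq_empty_iff.1 h
      infer_instance
    · exact (range_eq_univ.1 hrange).denseRange.separableSpace hf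
  exact UniformSpace.secondCountable_of_separable X

theorem measurable_edist_prod_rpow {Λ X Y : Type*} [MeasurableSpace Λ] [MeasurableSpace X]
    [PseudoEMetricSpace Y] [SecondCountableTopology Y] [MeasurableSpace Y] [OpensMeasurableSpace Y]
    {π : Λ → X → Y} (hπ : Measurable fun p : Λ × X => π p.1 p.2) (t : ℝ) :
    Measurable fun q : Λ × (X × X) => edist (π q.1 q.2.1) (π q.1 q.2.2) ^ t :=
  ((hπ.comp (measurable_fst.prodMk (measurable_fst.comp measurable_snd))).edist
    (hπ.comp (measurable_fst.prodMk (measurable_snd.comp measurable_snd)))).pow_const t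

namespace IsTransversal

variable {Λ X Y : Type*} [MeasurableSpace Λ] [MetricSpace X] [MetricSpace Y]
  {P Q : Measure Λ} {π : Λ → X → Y} {α κ C s : ℝ≥0}

theorem mono_measure (h : IsTransversal P π α κ C) (hQ : Q ≤ P) : IsTransversal Q π α κ C :=
  fun δ hδ x₁ x₂ hne => (hQ _).trans (h δ hδ x₁ x₂ hne)

theorem measure_edist_div_lt_le (h : IsTransversal P π α κ C) {x₁ x₂ : X} (hne : x₁ ≠ x₂) (k : ℕ) :
    P {l | edist (π l x₁) (π l x₂) / edist x₁ x₂ ^ (α : ℝ) < 2⁻¹ ^ k} ≤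
      C * (2 ^ (-(κ : ℝ))) ^ k := by
  have hδ : (0 : ℝ) < 2⁻¹ ^ k := by positivity
  have hδk : ENNReal.ofReal (2⁻¹ ^ k) = 2⁻¹ ^ k := by
    rw [ENNReal.ofReal_pow (by norm_num), ENNReal.ofReal_inv_of_pos two_pos, ENNReal.ofReal_ofNat]
  calc _ ≤ P {l | dist (π l x₁) (π l x₂) ≤ 2⁻¹ ^ k * dist x₁ x₂ ^ (α : ℝ)} := by
        gcongr with l
        intro hl
        rw [ENNReal.div_lt_iff (by simp [hne, edist_ne_top]) (by simp [edist_ne_top]),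
          edist_dist, edist_dist, ENNReal.ofReal_rpow_of_nonneg dist_nonneg α.coe_nonneg,
          ← hδk, ← ENNReal.ofReal_mul hδ.le] at hl
        exact ((ENNReal.ofReal_lt_ofReal_iff_of_nonneg dist_nonneg).1 hl).le
    _ ≤ ENNReal.ofReal (C * (2⁻¹ ^ k) ^ (κ : ℝ)) := h _ hδ x₁ x₂ hne
    _ = C * (2 ^ (-(κ : ℝ))) ^ k := by
        rw [ENNReal.ofReal_mul C.coe_nonneg, ENNReal.ofReal_coe_nnreal,
          ← ENNReal.ofReal_rpow_of_nonneg hδ.le κ.coe_nonneg, hδk, inv_two_pow_rpow]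

variable [SecondCountableTopology Y] [MeasurableSpace Y] [BorelSpace Y]

theorem lintegral_edist_rpow_neg_le (h : IsTransversal P π α κ C)
    (hπ : ∀ x, Measurable fun l => π l x) (hs : 0 < s) (hα : 0 < α) (x₁ x₂ : X) :
    ∫⁻ l, edist (π l x₁) (π l x₂) ^ (-(s : ℝ)) ∂P ≤
      (P univ + 1 + 2 ^ (s : ℝ) * C * (1 - 2 ^ ((s : ℝ) - κ))⁻¹) *
        edist x₁ x₂ ^ (-((α * s : ℝ≥0) : ℝ)) := by
  rcases eq_or_ne x₁ x₂ with rfl | hne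
  · rw [edist_self, ENNReal.zero_rpow_of_neg (neg_lt_zero.2 (by positivity)), ENNReal.mul_top]
    · exact le_top
    · exact (zero_lt_one.trans_le (le_add_self.trans le_self_add)).ne'
  set e : ℝ≥0∞ := edist x₁ x₂ ^ (α : ℝ) with he
  have he0 : e ≠ 0 := by simp [he, hne, edist_ne_top]
  have hetop : e ≠ ⊤ := by simp [he, edist_ne_top]
  have hW : Measurable fun l => edist (π l x₁) (π l x₂) / e :=
    ((hπ x₁).edist (hπ x₂)).div_const e
  have hpow (l : Λ) : edist (π l x₁) (π l x₂) ^ (-(s : ℝ)) =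
      (edist (π l x₁) (π l x₂) / e) ^ (-(s : ℝ)) * e ^ (-(s : ℝ)) := by
    rw [← ENNReal.mul_rpow_of_ne_top (ENNReal.div_ne_top (edist_ne_top _ _) he0) hetop,
      ENNReal.div_mul_cancel he0 hetop]
  have hexp : edist x₁ x₂ ^ (-((α * s : ℝ≥0) : ℝ)) = e ^ (-(s : ℝ)) := by
    rw [he, ← ENNReal.rpow_mul, NNReal.coe_mul, mul_neg]
  rw [hexp, lintegral_congr hpow, lintegral_mul_const _ (hW.pow_const _)]
  gcongr
  refine (lintegral_rpow_neg_le P hW (NNReal.coe_pos.2 hs) (h.measure_edist_div_lt_le hne)).trans ?_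
  gcongr
  exact le_self_add

variable [MeasurableSpace X]

theorem lintegral_lintegral_edist_rpow_neg_ne_top [IsFiniteMeasure P]
    (h : IsTransversal P π α κ C) (hπ : Measurable fun p : Λ × X => π p.1 p.2) (hs : 0 < s)
    (hα : 0 < α) (hsκ : s < κ) {ν : Measure (X × X)} [SFinite ν]
    (hν : ∫⁻ p, edist p.1 p.2 ^ (-((α * s : ℝ≥0) : ℝ)) ∂ν ≠ ⊤) :
    ∫⁻ l, ∫⁻ p, edist (π l p.1) (π l p.2) ^ (-(s : ℝ)) ∂ν ∂P ≠ ⊤ := by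
  have hA := add_two_rpow_mul_inv_one_sub_ne_top (NNReal.coe_lt_coe.2 hsκ)
    (ENNReal.add_ne_top.2 ⟨measure_ne_top P univ, ENNReal.one_ne_top⟩) (ENNReal.coe_ne_top (r := C))
  rw [lintegral_lintegral_swap (measurable_edist_prod_rpow hπ _).aemeasurable]
  refine ne_top_of_le_ne_top (ENNReal.mul_ne_top hA hν) ?_
  rw [← lintegral_const_mul' _ _ hA]
  exact lintegral_mono fun p => h.lintegral_edist_rpow_neg_le
    (fun x => hπ.comp measurable_prodMk_right) hs hα p.1 p.2

theorem ae_le_dimH_range_of_lt [BorelSpace X] [IsFiniteMeasure P] (h : IsTransversal P π α κ C)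
    (hX : AnalyticSet (univ : Set X)) (hπ : Measurable fun p : Λ × X => π p.1 p.2) (hα : 0 < α)
    (hs : 0 < s) (hsκ : s < κ) (hsX : (α * s : ℝ≥0) < dimH (univ : Set X)) :
    ∀ᵐ l ∂P, (s : ℝ≥0∞) ≤ dimH (range (π l)) := by
  have := secondCountableTopology_of_analyticSet_univ hX
  obtain ⟨u, hu, huX⟩ := ENNReal.lt_iff_exists_nnreal_btwn.1 hsX
  obtain ⟨-, -, -, μ, hμ, -, M, hM, hμM⟩ := exists_frostman_measure hX huX
  have hE := h.lintegral_lintegral_edist_rpow_neg_ne_top hπ hs hα hsκ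
    (lintegral_edist_rpow_neg_ne_top (NNReal.coe_pos.2 (mul_pos hα hs)) (by exact_mod_cast hu)
      hM hμM)
  filter_upwards [ae_lt_top (measurable_edist_prod_rpow hπ _).lintegral_prod_right' hE] with l hl
  exact le_dimH_range_of_lintegral_edist_rpow_neg_ne_top hμ.ne_zero
    (hπ.comp measurable_prodMk_left) hl.ne

theorem ae_min_le_dimH_range [BorelSpace X] [SFinite P] (h : IsTransversal P π α κ C)
    (hX : AnalyticSet (univ : Set X)) (hπ : Measurable fun p : Λ × X => π p.1 p.2) (hα : 0 < α) :
    ∀ᵐ l ∂P, min (κ : ℝ≥0∞) (dimH (univ : Set X) / α) ≤ dimH (range (π l)) := by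
  have hα0 : (α : ℝ≥0∞) ≠ 0 := ENNReal.coe_ne_zero.2 hα.ne'
  rw [← sum_sfiniteSeq P, Measure.ae_sum_iff]
  intro n
  have hn := h.mono_measure (sfiniteSeq_le P n)
  have hq (q : ℚ) : ∀ᵐ l ∂sfiniteSeq P n,
      (Real.toNNReal q : ℝ≥0∞) < min (κ : ℝ≥0∞) (dimH (univ : Set X) / α) →
        (Real.toNNReal q : ℝ≥0∞) ≤ dimH (range (π l)) := by
    rw [eventually_imp_distrib_left, lt_min_iff,
      ENNReal.lt_div_iff_mul_lt (.inl hα0) (.inl ENNReal.coe_ne_top), mul_comm]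
    rintro ⟨hqκ, hqX⟩
    rcases eq_or_ne (Real.toNNReal q) 0 with h0 | h0
    · simp [h0]
    · exact hn.ae_le_dimH_range_of_lt hX hπ hα (pos_iff_ne_zero.2 h0) (by exact_mod_cast hqκ)
        (by exact_mod_cast hqX)
  filter_upwards [ae_all_iff.2 hq] with l hl
  refine le_of_forall_lt fun r hr => ?_
  obtain ⟨q, -, hrq, hq⟩ := ENNReal.lt_iff_exists_rat_btwn.1 hr
  exact hrq.trans_le (hl q hq)

end IsTransversal

theorem dimH_range_le_min {X Y : Type*} [MetricSpace X] [MetricSpace Y] {f : X → Y} {α : ℝ≥0}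
    (hα : 0 < α)
    (hf : dimH (univ : Set X) < α * dimH (univ : Set Y) → ∃ K : ℝ≥0, HolderWith K α f) :
    dimH (range f) ≤ min (dimH (univ : Set Y)) (dimH (univ : Set X) / α) := by
  have hα0 : (α : ℝ≥0∞) ≠ 0 := ENNReal.coe_ne_zero.2 hα.ne'
  refine le_min (dimH_mono (subset_univ _)) ?_
  rcases lt_or_ge (dimH (univ : Set X)) (α * dimH (univ : Set Y)) with hlt | hge
  · obtain ⟨K, hK⟩ := hf hlt
    exact hK.dimH_range_le hα
  · rw [ENNReal.le_div_iff_mul_le (.inl hα0) (.inl ENNReal.coe_ne_top), mul_comm]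
    exact (mul_le_mul_right (dimH_mono (subset_univ _)) _).trans hge

theorem theorem1p1_general {X Y Λ : Type*} [MetricSpace X] [MeasurableSpace X] [BorelSpace X]
    (hX : AnalyticSet (univ : Set X))
    [MetricSpace Y] [TopologicalSpace.SeparableSpace Y] [MeasurableSpace Y] [BorelSpace Y]
    [MeasurableSpace Λ] (P : Measure Λ) [SFinite P]
    (π : Λ → X → Y) (hπ : Measurable fun p : Λ × X => π p.1 p.2)
    (α κ C : ℝ≥0) (hα : 0 < α) (htrans : IsTransversal P π α κ C) :
    (∀ᵐ l ∂P, min (κ : ℝ≥0∞) (dimH (univ : Set X) / α) ≤ dimH (range (π l))) ∧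
    ((κ : ℝ≥0∞) = dimH (univ : Set Y) →
      (dimH (univ : Set X) < (α : ℝ≥0∞) * κ → ∀ l, ∃ K : ℝ≥0, HolderWith K α (π l)) →
      ∀ᵐ l ∂P, dimH (range (π l)) = min (κ : ℝ≥0∞) (dimH (univ : Set X) / α)) := by
  have := UniformSpace.secondCountable_of_separable Y
  have hlower := htrans.ae_min_le_dimH_range hX hπ hα
  refine ⟨hlower, fun hκY hHolder => hlower.mono fun l hl => le_antisymm ?_ hl⟩
  rw [hκY] at hHolder ⊢
  exact dimH_range_le_min hα fun hlt => hHolder hlt l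

theorem analyticSet_univ_subtype {Z : Type*} [TopologicalSpace Z] {X : Set Z} (hX : AnalyticSet X) :
    AnalyticSet (univ : Set X) := by
  rw [AnalyticSet] at hX ⊢
  rcases hX with rfl | ⟨f, hf, rfl⟩
  · exact .inl (univ_eq_empty_iff.2 inferInstance)
  · exact .inr ⟨rangeFactorization f, hf.rangeFactorization, rangeFactorization_surjective.range_eq⟩

theorem dimH_univ_subtype {Z : Type*} [EMetricSpace Z] (X : Set Z) :
    dimH (univ : Set X) = dimH X := by
  rw [← isometry_subtype_coe.dimH_image, image_univ, Subtype.range_coe]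

theorem theorem1p1 {Z Y Λ : Type*}
    [MetricSpace Z] [CompleteSpace Z] [TopologicalSpace.SeparableSpace Z]
    [MeasurableSpace Z] [BorelSpace Z]
    [MetricSpace Y] [TopologicalSpace.SeparableSpace Y] [MeasurableSpace Y] [BorelSpace Y]
    [MeasurableSpace Λ] (P : Measure Λ) [IsProbabilityMeasure P]
    (X : Set Z) (hX : AnalyticSet X)
    (π : Λ → X → Y) (hπ : Measurable (fun p : Λ × X => π p.1 p.2))
    (α κ C : ℝ≥0) (hα : 0 < α) (hκ : 0 < κ) (hC : 0 < C)
    (htrans : IsTransversal P π α κ C) :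
    (∀ᵐ l ∂P, min (κ : ℝ≥0∞) (dimH X / α) ≤ dimH (range (π l))) ∧
    ((κ : ℝ≥0∞) = dimH (univ : Set Y) →
      (dimH X < (α : ℝ≥0∞) * κ → ∀ l, ∃ K : ℝ≥0, HolderWith K α (π l)) →
      ∀ᵐ l ∂P, dimH (range (π l)) = min (κ : ℝ≥0∞) (dimH X / α)) := by
  rw [← dimH_univ_subtype X]
  exact theorem1p1_general (analyticSet_univ_subtype hX) P π hπ α κ C hα htrans
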